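/- **Setting.** Simple types are generated by $\sigma,\tau ::= o \mid \sigma\to\tau$. Let $\Sigma$ be a ranked alphabet; a symbol of arity $n$ is a constant of type $o\to\cdots\to o\to o$ ($n$ arguments). *Recursion schemes.* A higher-order recursion scheme $\mathcal G$ over $\Sigma$ consists of a finite set $\mathcal N$ of simply-typed non-terminals, a start symbol $S\in\mathcal N$ of type $o$, and for each $F\in\mathcal N$ a term $\mathcal R(F)=\lambda x_1\ldots\lambda x_n.\,t$ of the same type as $F$, where $t$ has type $o$, contains no abstraction, and is built by application from symbols of $\Sigma$, non-terminals and $x_1,\dots,x_n$. It induces the rewrite rules $F\,t_1\cdots t_n\to t[x_i\leftarrow t_i]$, applicable anywhere in a term. The value tree $\langle\mathcal G\rangle$ is the partial $\Sigma$-labelled ranked tree in which position $p$ carries $a$ iff $S$ rewrites in finitely many steps to a term whose position $p$ is reached through symbols of $\Sigma$ only and carries $a$. (Positions at which the computation diverges carry no symbol.) *Automata.* An alternating parity tree automaton $\mathcal A$ over $\Sigma$ has a finite set $Q$ of states, a colouring $\Omega:Q\to\mathbb N$, and for $q\in Q$, $a\in\Sigma$ of arity $n$ a finite disjunction $\delta(q,a)$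 of conjunctive clauses, a clause being a finite set of pairs $(d,q')\in\{1,\dots,n\}\times Q$. A run-tree over a tree $T$ with initial state $q_0$ is a finitely branching tree whose nodes are labelled by pairs (position of $T$, state), with root labelled $(\text{root},q_0)$, such that for every node labelled $(p,q)$ the position $p$ carries a symbol $a$ in $T$ and, for some clause $\varphi$ of $\delta(q,a)$, the labels of its children are exactly the pairs $(p\cdot d,q')$ with $(d,q')\in\varphi$. It is accepting if along each infinite branch the greatest colour $\Omega(q)$ occurring infinitely often is even. *The model.* $\mathbf{FinScottL}$ has finite preorders as objects, and as morphisms $A\to B$ the relations $R\subseteq A\times B$ such that $(a,b)\in R$, $a\le a'$, $b'\le b$ imply $(a',b')\in R$; composition is relational. Put $A\otimes B=A\times B$, $A\multimap B=A^{op}\times B$, and let products $\&$ be disjoint unions, with $\top=\emptyset$. The comonad $!$ sends $A$ to its finite subsets, with $u\le v$ iff $\forall a\in u\,\exists b\in v\; a\le b$. Let $Col=\Omega(Q)\uplus\{\epsilon\}$ with $\epsilon$ below all other colours; the comonad $\Box$ sends $A$ to $Col\times A$, with $(c,a)\le(c',a')$ iff $c=c'$ and $a\le a'$, counit $\{((\epsilon,a),a')\mid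 a'\le a\}$ and comultiplication $\{((\max(c_1,c_2),a),(c_1,(c_2,a')))\mid a'\le a\}$. The distributive law $\{(\{(c_j,a'_j)\},(c,\{a_i\}))\mid\forall i\,\exists j\; c=c_j,\ a_i\le a'_j\}:{!}\Box A\to\Box{!}A$ makes ${!}\Box$ a comonad, whose Kleisli category is cartesian closed. Types are interpreted by $[\![o]\!]=(Q,=)$ and $[\![\sigma\to\tau]\!]={!}\Box[\![\sigma]\!]\multimap[\![\tau]\!]$, abstraction-free terms and the abstractions in $\mathcal R(F)$ by the cartesian closed structure, and $a\in\Sigma$ of arity $n$ by the set of $(\alpha_1,\dots,\alpha_n,q)$ for which some clause $\varphi$ of $\delta(q,a)$ satisfies $(\Omega(q'),q')\in\alpha_k$ for all $(k,q')\in\varphi$. *Fixpoints.* Let $R:{!}\Box X\otimes{!}\Box A\to A$. A semantic run-tree of $R$ producing $a$ is a finitely branching tree whose nodes have a label in $X\uplus A$ and a colour in $Col$; the root has label $a$ and colour $\epsilon$; nodes labelled in $X$ are leaves; and for each node labelled $b\in A$, if $u$ and $v$ are the sets of (colour, label) of its children labelled in $X$ and in $A$ respectively, then $((u,v),b)\in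 R$. It is winning if along each infinite branch some colour other than $\epsilon$ occurs infinitely often and the greatest such colour is even. Then $\mathbf Y_{X,A}(R)$ is the set of pairs $(u,a)$ for which there is a winning semantic run-tree of $R$ producing $a$ such that $u$ is the set of pairs $(c,x)$ with $x\in X$ the label of a leaf and $c$ the greatest colour on the path from the root to it (both included). The interpretation $[\![\mathcal G]\!]_{\mathcal A}\subseteq Q$ is the $S$-component of $\mathbf Y_{\top,N}(R)$, where $N$ is the product of the interpretations of the types of the non-terminals and $R:{!}\Box\top\otimes{!}\Box N\to N$ is given by the interpretations of the $\mathcal R(F)$, $F\in\mathcal N$. **Theorem.** Let $\mathcal G$ be a higher-order recursion scheme and $\mathcal A$ an alternating parity tree automaton over the same ranked alphabet $\Sigma$, and let $q_0$ be a state of $\mathcal A$. Then $\mathcal A$ has an accepting run-tree with initial state $q_0$ over the value tree $\langle\mathcal G\rangle$ if and only if $q_0\in[\![\mathcal G]\!]_{\mathcal A}$. -/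

import Mathlib

open CategoryTheory

namespace HOMC

/-! ### The category of finite preorders and downward-closed relations -/

/-- An object of `FinScottL`: a finite preordered set. -/
structure FinScottL where
  carrier : Type
  [pre : Preorder carrier]
  [fin : Finite carrier]

namespace FinScottL

attribute [instance] FinScottL.pre FinScottL.fin

instance : CoeSort FinScottL Type := ⟨FinScottL.carrier⟩

/-- A morphism `A ⟶ B`: a relation that is downward closed in `Aᵒᵖ × B`. -/
@[ext]
structure Hom (A B : FinScottL) where
  rel : A → B → Prop
  down : ∀ {a a' : A} {b b' : B}, rel a b → a ≤ a' → b' ≤ b → rel a' b'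

instance : Category FinScottL where
  Hom := Hom
  id _ := ⟨fun a' a => a ≤ a', fun h h1 h2 => h2.trans (h.trans h1)⟩
  comp R S := ⟨fun a c => ∃ b, R.rel a b ∧ S.rel b c,
    fun ⟨b, hR, hS⟩ h1 h2 => ⟨b, R.down hR h1 le_rfl, S.down hS le_rfl h2⟩⟩
  id_comp R := Hom.ext (funext fun _ => funext fun _ => propext
    ⟨fun ⟨_, h, hR⟩ => R.down hR h le_rfl, fun hR => ⟨_, le_rfl, hR⟩⟩)
  comp_id R := Hom.ext (funext fun _ => funext fun _ => propext
    ⟨fun ⟨_, hR, h⟩ => R.down hR le_rfl h, fun hR => ⟨_, hR, le_rfl⟩⟩)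
  assoc _ _ _ := Hom.ext (funext fun _ => funext fun _ => propext
    ⟨fun ⟨c, ⟨b, hR, hS⟩, hT⟩ => ⟨b, hR, c, hS, hT⟩,
     fun ⟨b, hR, c, hS, hT⟩ => ⟨c, ⟨b, hR, hS⟩, hT⟩⟩)

theorem hom_ext {A B : FinScottL} {R S : A ⟶ B} (h : ∀ a b, R.rel a b ↔ S.rel a b) : R = S :=
  Hom.ext (funext fun a => funext fun b => propext (h a b))

theorem id_rel {A : FinScottL} {a' a : A} : Hom.rel (𝟙 A) a' a ↔ a ≤ a' := Iff.rfl

theorem comp_rel {A B D : FinScottL} {R : A ⟶ B} {S : B ⟶ D} {a : A} {c : D} :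
    (R ≫ S).rel a c ↔ ∃ b, R.rel a b ∧ S.rel b c := Iff.rfl

/-- The object given by an explicit reflexive and transitive relation on a finite set. -/
abbrev ofRel (X : Type) [Finite X] (le : X → X → Prop) (refl : ∀ x, le x x)
    (trans : ∀ x y z, le x y → le y z → le x z) : FinScottL :=
  @FinScottL.mk X
    { le := le, lt := fun x y => le x y ∧ ¬ le y x, le_refl := refl, le_trans := trans,
      lt_iff_le_not_ge := fun _ _ => Iff.rfl } _

/-- The discrete preorder `(Q, =)`. -/
def discrete (Q : Type) [Finite Q] : FinScottL :=
  ofRel Q Eq (fun _ => rfl) (fun _ _ _ => Eq.trans)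

/-- The terminal object `⊤ = (∅, ∅)`. -/
def top : FinScottL := discrete Empty

/-- The tensor product, with the componentwise order. -/
def tensor (A B : FinScottL) : FinScottL := ⟨A × B⟩

/-- The linear arrow `A ⊸ B = Aᵒᵖ × B`. -/
def lolli (A B : FinScottL) : FinScottL :=
  ofRel (A × B) (fun x y => y.1 ≤ x.1 ∧ x.2 ≤ y.2)
    (fun _ => ⟨le_rfl, le_rfl⟩)
    (fun _ _ _ h k => ⟨k.1.trans h.1, h.2.trans k.2⟩)

/-- The binary product `A & B`: the disjoint union, elements of different summands being
incomparable. -/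
def prod (A B : FinScottL) : FinScottL := ⟨A ⊕ B⟩

/-- The product of a finite family: the disjoint union. -/
def pi {ι : Type} [Finite ι] (A : ι → FinScottL) : FinScottL := ⟨Σ i, A i⟩

/-- First projection. -/
def fst (A B : FinScottL) : prod A B ⟶ A where
  rel x a := ∃ a' : A, x = Sum.inl a' ∧ a ≤ a'
  down := by
    rintro x x' a b ⟨a', rfl, h⟩ hx hb
    cases hx with
    | inl hx => exact ⟨_, rfl, hb.trans (h.trans hx)⟩

/-- Second projection. -/
def snd (A B : FinScottL) : prod A B ⟶ B where
  rel x b := ∃ b' : B, x = Sum.inr b' ∧ b ≤ b'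
  down := by
    rintro x x' a b ⟨a', rfl, h⟩ hx hb
    cases hx with
    | inr hx => exact ⟨_, rfl, hb.trans (h.trans hx)⟩

/-- Projections of a finite product. -/
def proj {ι : Type} [Finite ι] (A : ι → FinScottL) (i : ι) : pi A ⟶ A i where
  rel x a := ∃ a' : A i, x = ⟨i, a'⟩ ∧ a ≤ a'
  down := by
    rintro x x' a b ⟨a', rfl, h⟩ hx hb
    cases hx with
    | fiber _ _ _ hx => exact ⟨_, rfl, hb.trans (h.trans hx)⟩

/-- Tupling into a finite product. -/
def tuple {ι : Type} [Finite ι] {D : FinScottL} {A : ι → FinScottL} (R : ∀ i, D ⟶ A i) :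
    D ⟶ pi A where
  rel d x := (R x.1).rel d x.2
  down := by
    rintro d d' x x' h hd hx
    cases hx with
    | fiber _ _ _ hx => exact (R _).down h hd hx

/-! ### The exponential modality -/

/-- `!A`: finite subsets, where `u ≤ v` iff every element of `u` is below an element of `v`. -/
def bangObj (A : FinScottL) : FinScottL :=
  ofRel (Finset A) (fun u v => ∀ a ∈ u, ∃ b ∈ v, a ≤ b)
    (fun _ a ha => ⟨a, ha, le_rfl⟩)
    (fun _ _ _ h k a ha =>
      let ⟨b, hb, hab⟩ := h a ha
      let ⟨c, hc, hbc⟩ := k b hb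
      ⟨c, hc, hab.trans hbc⟩)

/-- The action of `!` on morphisms. -/
def bangMap {A B : FinScottL} (R : A ⟶ B) : bangObj A ⟶ bangObj B where
  rel (u : Finset A) (v : Finset B) := ∀ b ∈ v, ∃ a ∈ u, R.rel a b
  down := by
    intro u u' v v' h hu hv b hb
    obtain ⟨b1, hb1, hbb⟩ := hv b hb
    obtain ⟨a, ha, hab⟩ := h b1 hb1
    obtain ⟨a1, ha1, haa⟩ := hu a ha
    exact ⟨a1, ha1, R.down hab haa hbb⟩

/-- The dereliction `!A ⟶ A`. -/
def bangDer (A : FinScottL) : bangObj A ⟶ A where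
  rel (u : Finset A) a := ∃ a' ∈ u, a ≤ a'
  down := by
    rintro u u' a b ⟨a', ha', h⟩ hu hb
    obtain ⟨a1, ha1, haa⟩ := hu a' ha'
    exact ⟨a1, ha1, hb.trans (h.trans haa)⟩

/-- The digging `!A ⟶ !!A`. -/
def bangDig (A : FinScottL) : bangObj A ⟶ bangObj (bangObj A) where
  rel (u : bangObj A) (U : Finset (bangObj A)) := ∀ v ∈ U, v ≤ u
  down := by
    intro u u' U U' h hu hU v hv
    obtain ⟨v1, hv1, hvv⟩ := hU v hv
    exact hvv.trans ((h v1 hv1).trans hu)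

/-- In a finite set every predicate carves out a finite subset. -/
theorem exists_finset {α : Type} [Finite α] (p : α → Prop) :
    ∃ s : Finset α, ∀ x, x ∈ s ↔ p x :=
  ⟨(Set.toFinite {x | p x}).toFinset, by simp⟩

/-- The comonad `!`. -/
def bang : Comonad FinScottL where
  obj := bangObj
  map := bangMap
  map_id A := hom_ext fun u v => Iff.rfl
  map_comp {A B D} R S := hom_ext fun u w => by
    constructor
    · intro h
      obtain ⟨v, hv⟩ := exists_finset fun b : B => ∃ a ∈ (show Finset A from u), R.rel a b
      refine ⟨v, fun b hb => (hv b).1 hb, fun c hc => ?_⟩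
      obtain ⟨a, ha, b, hab, hbc⟩ := h c hc
      exact ⟨b, (hv b).2 ⟨a, ha, hab⟩, hbc⟩
    · rintro ⟨v, h, k⟩ c hc
      obtain ⟨b, hb, hbc⟩ := k c hc
      obtain ⟨a, ha, hab⟩ := h b hb
      exact ⟨a, ha, b, hab, hbc⟩
  ε :=
    { app := bangDer
      naturality := fun A B R => hom_ext fun u b => by
        constructor
        · rintro ⟨v, h, b', hb', hbb⟩
          obtain ⟨a, ha, hab⟩ := h b' hb'
          exact ⟨a, ⟨a, ha, le_rfl⟩, R.down hab le_rfl hbb⟩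
        · rintro ⟨a, ⟨a', ha', haa⟩, hab⟩
          refine ⟨({b} : Finset B), fun b' hb' => ?_, b, Finset.mem_singleton_self b, le_rfl⟩
          obtain rfl := Finset.mem_singleton.1 hb'
          exact ⟨a', ha', R.down hab haa le_rfl⟩ }
  δ :=
    { app := bangDig
      naturality := fun A B R => hom_ext fun u V => by
        constructor
        · rintro ⟨v, h, hV⟩
          refine ⟨({u} : Finset (bangObj A)), fun u' hu' => ?_, fun v' hv' =>
            ⟨u, Finset.mem_singleton_self u, fun b hb => ?_⟩⟩
          · obtain rfl := Finset.mem_singleton.1 hu'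
            exact le_rfl
          · obtain ⟨b', hb', hbb⟩ := hV v' hv' b hb
            obtain ⟨a, ha, hab⟩ := h b' hb'
            exact ⟨a, ha, R.down hab le_rfl hbb⟩
        · rintro ⟨U, hU, h⟩
          obtain ⟨v, hv⟩ := exists_finset fun b : B => ∃ a ∈ (show Finset A from u), R.rel a b
          refine ⟨v, fun b hb => (hv b).1 hb, fun v' hv' b hb => ⟨b, (hv b).2 ?_, le_rfl⟩⟩
          obtain ⟨u', hu', hR⟩ := h v' hv'
          obtain ⟨a, ha, hab⟩ := hR b hb
          obtain ⟨a', ha', haa⟩ := hU u' hu' a ha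
          exact ⟨a', ha', R.down hab haa le_rfl⟩ }
  coassoc A := hom_ext fun u W => by
    constructor
    · rintro ⟨U, hU, h⟩
      refine ⟨({u} : Finset (bangObj A)), fun v hv => ?_, fun V hV v hv =>
        ⟨u, Finset.mem_singleton_self u, ?_⟩⟩
      · obtain rfl := Finset.mem_singleton.1 hv
        exact le_rfl
      · obtain ⟨u', hu', hVu⟩ := h V hV
        exact (hVu v hv).trans (hU u' hu')
    · rintro ⟨U, hU, h⟩
      refine ⟨({u} : Finset (bangObj A)), fun v hv => ?_, fun V hV =>
        ⟨u, Finset.mem_singleton_self u, fun v hv => ?_⟩⟩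
      · obtain rfl := Finset.mem_singleton.1 hv
        exact le_rfl
      · obtain ⟨u', hu', hVu⟩ := h V hV v hv
        exact hVu.trans (hU u' hu')
  left_counit A := hom_ext fun u v => by
    constructor
    · rintro ⟨U, hU, v', hv', h⟩
      exact h.trans (hU v' hv')
    · intro h
      refine ⟨({u} : Finset (bangObj A)), fun w hw => ?_, u, Finset.mem_singleton_self u, h⟩
      obtain rfl := Finset.mem_singleton.1 hw
      exact le_rfl
  right_counit A := hom_ext fun u v => by
    constructor
    · rintro ⟨U, hU, h⟩ a ha
      obtain ⟨v', hv', a', ha', haa⟩ := h a ha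
      obtain ⟨a1, ha1, h1⟩ := hU v' hv' a' ha'
      exact ⟨a1, ha1, haa.trans h1⟩
    · intro h
      refine ⟨({u} : Finset (bangObj A)), fun w hw => ?_, fun a ha =>
        ⟨u, Finset.mem_singleton_self u, h a ha⟩⟩
      obtain rfl := Finset.mem_singleton.1 hw
      exact le_rfl

/-! ### The colouring comonad, for a finite chain of colours with neutral (least) colour `⊥` -/

/-- `□A`: one copy of `A` for each colour. -/
def boxObj (C : Type) [Finite C] (A : FinScottL) : FinScottL :=
  ofRel (C × A) (fun x y => x.1 = y.1 ∧ x.2 ≤ y.2)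
    (fun _ => ⟨rfl, le_rfl⟩)
    (fun _ _ _ h k => ⟨h.1.trans k.1, h.2.trans k.2⟩)

section Colours

variable (C : Type) [Finite C] [LinearOrder C] [OrderBot C]

/-- The action of `□` on morphisms. -/
def boxMap {A B : FinScottL} (R : A ⟶ B) : boxObj C A ⟶ boxObj C B where
  rel (x : C × A) (y : C × B) := x.1 = y.1 ∧ R.rel x.2 y.2
  down := fun h h1 h2 => ⟨h1.1.symm.trans (h.1.trans h2.1.symm), R.down h.2 h1.2 h2.2⟩

/-- The counit `□A ⟶ A`. -/
def boxDer (A : FinScottL) : boxObj C A ⟶ A where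
  rel (x : C × A) a := x.1 = ⊥ ∧ a ≤ x.2
  down := fun h h1 h2 => ⟨h1.1.symm.trans h.1, h2.trans (h.2.trans h1.2)⟩

/-- The comultiplication `□A ⟶ □□A`. -/
def boxDig (A : FinScottL) : boxObj C A ⟶ boxObj C (boxObj C A) where
  rel (x : C × A) (y : C × (C × A)) := x.1 = max y.1 y.2.1 ∧ y.2.2 ≤ x.2
  down := by
    rintro ⟨c, a⟩ ⟨c', a'⟩ ⟨d, e, b⟩ ⟨d', e', b'⟩ ⟨h, k⟩ ⟨h1, k1⟩ ⟨h2, h3, k3⟩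
    dsimp only at *
    subst h1 h2 h3
    exact ⟨h, k3.trans (k.trans k1)⟩

/-- The comonad `□`. -/
def box : Comonad FinScottL where
  obj := boxObj C
  map := boxMap C
  map_id A := hom_ext fun x y => ⟨fun h => ⟨h.1.symm, h.2⟩, fun h => ⟨h.1.symm, h.2⟩⟩
  map_comp R S := hom_ext fun x z =>
    ⟨fun ⟨h, b, hR, hS⟩ => ⟨(x.1, b), ⟨rfl, hR⟩, h, hS⟩,
     fun ⟨y, ⟨h, hR⟩, k, hS⟩ => ⟨h.trans k, y.2, hR, hS⟩⟩
  ε :=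
    { app := boxDer C
      naturality := fun A B R => hom_ext fun x b =>
        ⟨fun ⟨_, ⟨h, hR⟩, k, hb⟩ => ⟨x.2, ⟨h.trans k, le_rfl⟩, R.down hR le_rfl hb⟩,
         fun ⟨a, ⟨h, ha⟩, hR⟩ => ⟨(x.1, b), ⟨rfl, R.down hR ha le_rfl⟩, h, le_rfl⟩⟩ }
  δ :=
    { app := boxDig C
      naturality := fun A B R => hom_ext fun x y =>
        ⟨fun ⟨_, ⟨h, hR⟩, k, hb⟩ => ⟨(y.1, y.2.1, x.2), ⟨h.trans k, le_rfl⟩, rfl, rfl,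
            R.down hR le_rfl hb⟩,
         fun ⟨_, ⟨h, ha⟩, k, l, hR⟩ => ⟨(x.1, y.2.2), ⟨rfl, R.down hR ha le_rfl⟩,
            by rw [h, k, l], le_rfl⟩⟩ }
  coassoc A := hom_ext fun x y => by
    obtain ⟨c, a⟩ := x
    obtain ⟨c1, c2, c3, b⟩ := y
    constructor
    · rintro ⟨⟨d, e, f⟩, ⟨h, ha⟩, k, l, hb⟩
      dsimp only at *
      subst h k l
      exact ⟨(max d c2, c3, a), ⟨(max_assoc _ _ _).symm, le_rfl⟩, rfl, rfl, hb.trans ha⟩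
    · rintro ⟨⟨d, e, f⟩, ⟨h, ha⟩, k, l, hb⟩
      dsimp only at *
      subst h k l
      exact ⟨(c1, max c2 c3, a), ⟨max_assoc _ _ _, le_rfl⟩, rfl, rfl, hb.trans ha⟩
  left_counit A := hom_ext fun x y => by
    obtain ⟨c, a⟩ := x
    obtain ⟨d, b⟩ := y
    constructor
    · rintro ⟨⟨e, f, g⟩, ⟨h, ha⟩, k, l, hb⟩
      dsimp only at *
      subst k l
      exact ⟨by simp [h], hb.trans ha⟩
    · rintro ⟨h, hb⟩
      dsimp only at *
      subst h
      exact ⟨(⊥, d, a), ⟨by simp, le_rfl⟩, rfl, rfl, hb⟩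
  right_counit A := hom_ext fun x y => by
    obtain ⟨c, a⟩ := x
    obtain ⟨d, b⟩ := y
    constructor
    · rintro ⟨⟨e, f, g⟩, ⟨h, ha⟩, k, l, hb⟩
      dsimp only at *
      subst k l
      exact ⟨by simp [h], hb.trans ha⟩
    · rintro ⟨h, hb⟩
      dsimp only at *
      subst h
      exact ⟨(d, ⊥, a), ⟨by simp, le_rfl⟩, rfl, rfl, hb⟩

/-- The distributive law `λ : !□ ⟶ □!`. -/
def dist : (box C).toFunctor ⋙ bang.toFunctor ⟶ bang.toFunctor ⋙ (box C).toFunctor where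
  app A :=
    { rel := fun (u : Finset (C × A)) (y : C × Finset A) =>
        ∀ a ∈ y.2, ∃ x ∈ u, y.1 = x.1 ∧ a ≤ x.2
      down := by
        rintro u u' ⟨c, v⟩ ⟨c', v'⟩ h hu ⟨hc, hv⟩ a ha
        obtain ⟨a1, ha1, haa⟩ := hv a ha
        obtain ⟨x, hx, hcx, hax⟩ := h a1 ha1
        obtain ⟨x', hx', hcx', hax'⟩ := hu x hx
        exact ⟨x', hx', hc.trans (hcx.trans hcx'), haa.trans (hax.trans hax')⟩ }
  naturality A B R := hom_ext fun u y => by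
    constructor
    · rintro ⟨v, h, k⟩
      obtain ⟨w, hw⟩ := exists_finset fun a : A => ∃ x ∈ (show Finset (C × A) from u), y.1 = x.1 ∧ a ≤ x.2
      refine ⟨(y.1, w), fun a ha => (hw a).1 ha, rfl, fun b hb => ?_⟩
      obtain ⟨z, hz, hyz, hbz⟩ := k b hb
      obtain ⟨x, hx, hxz, hR⟩ := h z hz
      exact ⟨x.2, (hw _).2 ⟨x, hx, hyz.trans hxz.symm, le_rfl⟩, R.down hR le_rfl hbz⟩
    · rintro ⟨w, h, hwy, k⟩
      obtain ⟨v, hv⟩ := exists_finset fun z : C × B => ∃ x ∈ (show Finset (C × A) from u),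
        x.1 = z.1 ∧ R.rel x.2 z.2
      refine ⟨v, fun z hz => (hv z).1 hz, fun b hb => ?_⟩
      obtain ⟨a, ha, hR⟩ := k b hb
      obtain ⟨x, hx, hwx, hax⟩ := h a ha
      exact ⟨(y.1, b), (hv _).2 ⟨x, hx, hwx.symm.trans hwy, R.down hR hax le_rfl⟩, rfl, le_rfl⟩

/-- The object part of the coloured exponential `!□`. -/
abbrev cbObj (A : FinScottL) : FinScottL := bangObj (boxObj C A)

/-- The counit `!□A ⟶ □A ⟶ A` of the coloured exponential. -/
def cbDer (A : FinScottL) : cbObj C A ⟶ A := bangDer (boxObj C A) ≫ boxDer C A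

/-- The comultiplication `!□A ⟶ !!□A ⟶ !!□□A ⟶ !□!□A` of the coloured exponential. -/
def cbDig (A : FinScottL) : cbObj C A ⟶ cbObj C (cbObj C A) :=
  bangDig (boxObj C A) ≫ bangMap (bangMap (boxDig C A)) ≫ bangMap ((dist C).app (boxObj C A))

theorem cbDer_rel {A : FinScottL} {u : Finset (C × A)} {a : A} :
    (cbDer C A).rel u a ↔ ∃ a', (⊥, a') ∈ u ∧ a ≤ a' := by
  constructor
  · rintro ⟨⟨c, b⟩, ⟨⟨d, e⟩, hx, h, h'⟩, k, k'⟩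
    dsimp only at *
    subst h k
    exact ⟨e, hx, k'.trans h'⟩
  · rintro ⟨a', h, k⟩
    exact ⟨(⊥, a'), ⟨_, h, le_rfl⟩, rfl, k⟩

theorem cbDig_rel {A : FinScottL} {u : Finset (C × A)} {V : Finset (C × Finset (C × A))} :
    (cbDig C A).rel u V ↔
      ∀ y ∈ V, ∀ z ∈ y.2, ∃ a', (max y.1 z.1, a') ∈ u ∧ z.2 ≤ a' := by
  constructor
  · rintro ⟨U, hU, W, hW, hV⟩ y hy z hz
    obtain ⟨w, hw, h⟩ := hV y hy
    obtain ⟨x, hx, hxy, hzx⟩ := h z hz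
    obtain ⟨t, ht, h2⟩ := hW w hw
    obtain ⟨s, hs, h3, h4⟩ := h2 x hx
    obtain ⟨r, hr, h5, h6⟩ := hU t ht s hs
    refine ⟨r.2, ?_, hzx.2.trans (h4.trans h6)⟩
    rw [hxy, hzx.1, ← h3, h5]
    exact hr
  · intro h
    obtain ⟨w, hw⟩ := exists_finset fun x : C × (C × A) =>
      ∃ a', (max x.1 x.2.1, a') ∈ u ∧ x.2.2 ≤ a'
    refine ⟨({u} : Finset (bangObj (boxObj C A))), fun v hv => ?_,
      ({w} : Finset (bangObj (boxObj C (boxObj C A)))), fun v hv => ?_, fun y hy => ?_⟩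
    · obtain rfl := Finset.mem_singleton.1 hv
      exact le_rfl
    · obtain rfl := Finset.mem_singleton.1 hv
      refine ⟨u, Finset.mem_singleton_self u, fun x hx => ?_⟩
      obtain ⟨a', ha', h'⟩ := (hw x).1 hx
      exact ⟨_, ha', rfl, h'⟩
    · refine ⟨w, Finset.mem_singleton_self w, fun z hz => ?_⟩
      exact ⟨(y.1, z), (hw _).2 (h y hy z hz), rfl, le_rfl⟩

/-- The coloured exponential comonad `!□`; a morphism `A ⟶ B` of its Kleisli category
`CategoryTheory.Cokleisli (cb C)` is a morphism `!□A ⟶ B` of `FinScottL`. -/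
def cb : Comonad FinScottL where
  toFunctor := (box C).toFunctor ⋙ bang.toFunctor
  ε :=
    { app := cbDer C
      naturality := fun A B R => hom_ext fun u b => by
        constructor
        · rintro ⟨v, h, k⟩
          obtain ⟨b', hb', hbb⟩ := (cbDer_rel C).1 k
          obtain ⟨x, hx, hxb, hR⟩ := h _ hb'
          refine ⟨x.2, (cbDer_rel C).2 ⟨x.2, ?_, le_rfl⟩, R.down hR le_rfl hbb⟩
          rw [← (show x.1 = ⊥ from hxb)]
          exact hx
        · rintro ⟨a, h, hR⟩
          obtain ⟨a', ha', haa⟩ := (cbDer_rel C).1 h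
          refine ⟨({(⊥, b)} : Finset (C × B)), fun y hy => ?_,
            (cbDer_rel C).2 ⟨b, Finset.mem_singleton_self _, le_rfl⟩⟩
          obtain rfl := Finset.mem_singleton.1 hy
          exact ⟨_, ha', rfl, R.down hR haa le_rfl⟩ }
  δ :=
    { app := cbDig C
      naturality := fun A B R => hom_ext fun u V => by
        constructor
        · rintro ⟨v, h, k⟩
          have k := (cbDig_rel C).1 k
          obtain ⟨U, hU⟩ := exists_finset fun y : C × Finset (C × A) =>
            ∀ z ∈ y.2, ∃ a', (max y.1 z.1, a') ∈ (show Finset (C × A) from u) ∧ z.2 ≤ a'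
          refine ⟨U, (cbDig_rel C).2 fun y hy => (hU y).1 hy, fun y hy => ?_⟩
          obtain ⟨w, hw⟩ := exists_finset fun z : C × A =>
            ∃ a', (max y.1 z.1, a') ∈ (show Finset (C × A) from u) ∧ z.2 ≤ a'
          refine ⟨(y.1, w), (hU _).2 fun z hz => (hw z).1 hz, rfl, fun b hb => ?_⟩
          obtain ⟨b', hb', hbb⟩ := k y hy b hb
          obtain ⟨x, hx, hxb, hR⟩ := h _ hb'
          refine ⟨(b.1, x.2), (hw _).2 ⟨x.2, ?_, le_rfl⟩, rfl, R.down hR le_rfl hbb⟩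
          rw [← (show x.1 = max y.1 b.1 from hxb)]
          exact hx
        · rintro ⟨U, k, h⟩
          have k := (cbDig_rel C).1 k
          obtain ⟨v, hv⟩ := exists_finset fun z : C × B =>
            ∃ x ∈ (show Finset (C × A) from u), x.1 = z.1 ∧ R.rel x.2 z.2
          refine ⟨v, fun z hz => (hv z).1 hz, (cbDig_rel C).2 fun y hy z hz =>
            ⟨z.2, (hv _).2 ?_, le_rfl⟩⟩
          obtain ⟨y', hy', hyy, h'⟩ := h y hy
          obtain ⟨x, hx, hxz, hR⟩ := h' z hz
          obtain ⟨a', ha', haa⟩ := k y' hy' x hx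
          refine ⟨_, ha', ?_, R.down hR haa le_rfl⟩
          rw [show y'.1 = y.1 from hyy, show x.1 = z.1 from hxz] }
  coassoc A := hom_ext fun u W => by
    obtain ⟨U, hU⟩ := exists_finset fun y : C × Finset (C × A) =>
      ∀ z ∈ y.2, ∃ a', (max y.1 z.1, a') ∈ (show Finset (C × A) from u) ∧ z.2 ≤ a'
    constructor
    · rintro ⟨U', hU', h⟩
      have hU' := (cbDig_rel C).1 hU'
      refine ⟨U, (cbDig_rel C).2 fun y hy => (hU y).1 hy, (cbDig_rel C).2 fun Y hY y hy =>
        ⟨y.2, (hU _).2 fun z hz => ?_, le_rfl⟩⟩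
      obtain ⟨t, ht, htY, h'⟩ := h Y hY
      obtain ⟨a, ha, haa⟩ := (cbDig_rel C).1 h' y hy z hz
      obtain ⟨a', ha', haa'⟩ := hU' t ht _ ha
      refine ⟨a', ?_, haa.trans haa'⟩
      dsimp only
      rw [← (show t.1 = Y.1 from htY), max_assoc]
      exact ha'
    · rintro ⟨U', hU', h⟩
      have hU' := (cbDig_rel C).1 hU'
      have h := (cbDig_rel C).1 h
      refine ⟨U, (cbDig_rel C).2 fun y hy => (hU y).1 hy, fun Y hY => ?_⟩
      obtain ⟨v, hv⟩ := exists_finset fun z : C × A =>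
        ∃ a', (max Y.1 z.1, a') ∈ (show Finset (C × A) from u) ∧ z.2 ≤ a'
      refine ⟨(Y.1, v), (hU _).2 fun z hz => (hv z).1 hz, rfl, (cbDig_rel C).2 fun y hy z hz =>
        ⟨z.2, (hv _).2 ?_, le_rfl⟩⟩
      obtain ⟨w, hw, hyw⟩ := h Y hY y hy
      obtain ⟨z', hz', hzz, hzz'⟩ := hyw z hz
      obtain ⟨a', ha', haa⟩ := hU' _ hw z' hz'
      refine ⟨a', ?_, hzz'.trans haa⟩
      dsimp only
      rw [show z.1 = z'.1 from hzz, ← max_assoc]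
      exact ha'
  left_counit A := hom_ext fun u v => by
    constructor
    · rintro ⟨U, hU, h⟩
      have hU := (cbDig_rel C).1 hU
      obtain ⟨v', hv', hvv⟩ := (cbDer_rel C).1 h
      intro z hz
      obtain ⟨z', hz', hzz, hzz'⟩ := hvv z hz
      obtain ⟨a', ha', haa⟩ := hU _ hv' z' hz'
      exact ⟨_, ha', by simp [show z.1 = z'.1 from hzz], hzz'.trans haa⟩
    · intro h
      refine ⟨({(⊥, v)} : Finset (C × Finset (C × A))), (cbDig_rel C).2 fun y hy z hz => ?_,
        (cbDer_rel C).2 ⟨v, Finset.mem_singleton_self _, le_rfl⟩⟩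
      obtain rfl := Finset.mem_singleton.1 hy
      obtain ⟨x, hx, h1, h2⟩ := h z hz
      refine ⟨x.2, ?_, h2⟩
      rw [max_eq_right bot_le, show z.1 = x.1 from h1]
      exact hx
  right_counit A := hom_ext fun u v => by
    constructor
    · rintro ⟨U, hU, h⟩ z hz
      have hU := (cbDig_rel C).1 hU
      obtain ⟨y, hy, hyz, h'⟩ := h z hz
      obtain ⟨a, ha, haa⟩ := (cbDer_rel C).1 h'
      obtain ⟨a', ha', haa'⟩ := hU y hy _ ha
      exact ⟨_, ha', by simp [show y.1 = z.1 from hyz], haa.trans haa'⟩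
    · intro h
      obtain ⟨U, hU⟩ := exists_finset fun y : C × Finset (C × A) =>
        ∀ z ∈ y.2, ∃ a', (max y.1 z.1, a') ∈ (show Finset (C × A) from u) ∧ z.2 ≤ a'
      refine ⟨U, (cbDig_rel C).2 fun y hy => (hU y).1 hy, fun z hz => ?_⟩
      obtain ⟨x, hx, h1, h2⟩ := h z hz
      refine ⟨(z.1, ({(⊥, z.2)} : Finset (C × A))), (hU _).2 fun t ht => ?_, rfl,
        (cbDer_rel C).2 ⟨z.2, Finset.mem_singleton_self _, le_rfl⟩⟩
      obtain rfl := Finset.mem_singleton.1 ht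
      refine ⟨x.2, ?_, h2⟩
      dsimp only
      rw [max_eq_left bot_le, show z.1 = x.1 from h1]
      exact hx

end Colours

end FinScottL

/-! ### Labelled trees -/

/-- A possibly infinite, finitely branching tree with nodes labelled in `L`. Nodes are finite
sequences of natural numbers, the root is `[]`, the children of `p` are the nodes `p ++ [i]`.
The values of `label` outside `nodes` are irrelevant. -/
structure LTree (L : Type) where
  nodes : Set (List ℕ)
  root_mem : [] ∈ nodes
  parent_mem : ∀ p i, p ++ [i] ∈ nodes → p ∈ nodes
  finite_children : ∀ p, {i | p ++ [i] ∈ nodes}.Finite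
  label : List ℕ → L

namespace LTree

variable {L : Type} (t : LTree L)

/-- The prefix of length `n` of an infinite sequence of directions. -/
def pref (b : ℕ → ℕ) (n : ℕ) : List ℕ := (List.range n).map b

/-- `b` is an infinite branch of `t`. -/
def IsBranch (b : ℕ → ℕ) : Prop := ∀ n, pref b n ∈ t.nodes

/-- `l` is the label of a child of the node `p`. -/
def ChildLabel (p : List ℕ) (l : L) : Prop := ∃ i, p ++ [i] ∈ t.nodes ∧ t.label (p ++ [i]) = l

end LTree

/-! ### Simple types, higher-order recursion schemes and value trees -/

/-- A ranked alphabet. -/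
structure Sig where
  sym : Type
  ar : sym → ℕ

/-- Simple types over the ground type `o`. -/
inductive Ty where
  | o : Ty
  | arr : Ty → Ty → Ty

/-- The type `o → ⋯ → o → o` of a symbol of arity `n`. -/
def Ty.first : ℕ → Ty
  | 0 => .o
  | n + 1 => .arr .o (Ty.first n)

/-- Variables (de Bruijn indices) of type `σ` in a context. -/
inductive Var : List Ty → Ty → Type
  | zero {Γ : List Ty} {σ : Ty} : Var (σ :: Γ) σ
  | succ {Γ : List Ty} {σ τ : Ty} : Var Γ σ → Var (τ :: Γ) σ

/-- Simply-typed terms without abstraction, built from the symbols of the alphabet,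
the non-terminals and the variables of a context. -/
inductive Term (S : Sig) {N : Type} (ty : N → Ty) (Γ : List Ty) : Ty → Type
  | const (a : S.sym) : Term S ty Γ (Ty.first (S.ar a))
  | nt (F : N) : Term S ty Γ (ty F)
  | var {σ : Ty} (x : Var Γ σ) : Term S ty Γ σ
  | app {σ τ : Ty} (M : Term S ty Γ (.arr σ τ)) (M' : Term S ty Γ σ) : Term S ty Γ τ

/-- Right-hand sides `λx₁. … λxₙ. t`, where `t` has ground type and no abstraction. -/
inductive Rule (S : Sig) {N : Type} (ty : N → Ty) : List Ty → Ty → Type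
  | body {Γ : List Ty} (t : Term S ty Γ .o) : Rule S ty Γ .o
  | lam {Γ : List Ty} {σ τ : Ty} (r : Rule S ty (σ :: Γ) τ) : Rule S ty Γ (.arr σ τ)

/-- A higher-order recursion scheme. -/
structure HORS (S : Sig) where
  N : Type
  [finN : Finite N]
  ty : N → Ty
  start : N
  start_ty : ty start = .o
  rule : ∀ F, Rule S ty [] (ty F)

attribute [instance] HORS.finN

section Rewriting

variable {S : Sig} {N : Type} {ty : N → Ty}

/-- Closed terms for the variables of a context. -/
abbrev Env (S : Sig) {N : Type} (ty : N → Ty) (Γ : List Ty) : Type :=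
  ∀ σ, Var Γ σ → Term S ty [] σ

/-- Extension of an environment by one more term. -/
def Env.cons {Γ : List Ty} {τ : Ty} (t : Term S ty [] τ) (ρ : Env S ty Γ) : Env S ty (τ :: Γ)
  | _, .zero => t
  | _, .succ x => ρ _ x

/-- The empty environment. -/
def Env.nil : Env S ty [] := fun _ x => nomatch x

/-- Simultaneous substitution of closed terms. -/
def Term.subst {Γ : List Ty} (ρ : Env S ty Γ) : ∀ {σ : Ty}, Term S ty Γ σ → Term S ty [] σ
  | _, .const a => .const a
  | _, .nt F => .nt F
  | _, .var x => ρ _ x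
  | _, .app M M' => .app (M.subst ρ) (M'.subst ρ)

/-- Sequences of closed arguments that bring a term of the given type to ground type. -/
inductive Args (S : Sig) {N : Type} (ty : N → Ty) : Ty → Type
  | nil : Args S ty .o
  | cons {σ τ : Ty} (t : Term S ty [] σ) (as : Args S ty τ) : Args S ty (.arr σ τ)

/-- The term `M t₁ … tₙ`. -/
def Args.apply : ∀ {σ : Ty}, Term S ty [] σ → Args S ty σ → Term S ty [] .o
  | _, M, .nil => M
  | _, M, .cons t as => as.apply (.app M t)

/-- The term `t[xᵢ ← tᵢ]`, for a right-hand side `λx₁. … λxₙ. t`. -/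
def Rule.inst : ∀ {Γ : List Ty} {σ : Ty}, Rule S ty Γ σ → Env S ty Γ → Args S ty σ →
    Term S ty [] .o
  | _, _, .body t, ρ, .nil => t.subst ρ
  | _, _, .lam r, ρ, .cons t as => r.inst (Env.cons t ρ) as

/-- The term `M t₁ … tₙ` for `M` of type `o → ⋯ → o → o`. -/
def Term.appN : ∀ {n : ℕ}, Term S ty [] (Ty.first n) → (Fin n → Term S ty [] .o) →
    Term S ty [] .o
  | 0, M, _ => M
  | _ + 1, M, ts => Term.appN (.app M (ts 0)) fun i => ts i.succ

/-- `LabelAt t p a`: the position `p` of the term `t` is reached through symbols of the alphabet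
only, and carries the symbol `a`. -/
inductive LabelAt : Term S ty [] .o → List ℕ → S.sym → Prop
  | root (a : S.sym) (ts : Fin (S.ar a) → Term S ty [] .o) :
      LabelAt (Term.appN (.const a) ts) [] a
  | child (a : S.sym) (ts : Fin (S.ar a) → Term S ty [] .o) (i : Fin (S.ar a)) (p : List ℕ)
      (b : S.sym) (h : LabelAt (ts i) p b) : LabelAt (Term.appN (.const a) ts) (i.val :: p) b

end Rewriting

namespace HORS

variable {S : Sig} (G : HORS S)

/-- The rewriting relation: `F t₁ … tₙ ⟶ t[xᵢ ← tᵢ]`, at any place of a term. -/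
inductive Step : ∀ {σ : Ty}, Term S G.ty [] σ → Term S G.ty [] σ → Prop
  | rule (F : G.N) (as : Args S G.ty (G.ty F)) :
      Step (as.apply (.nt F)) ((G.rule F).inst Env.nil as)
  | left {σ τ : Ty} {M M' : Term S G.ty [] (.arr σ τ)} (P : Term S G.ty [] σ) (h : Step M M') :
      Step (.app M P) (.app M' P)
  | right {σ τ : Ty} (M : Term S G.ty [] (.arr σ τ)) {P P' : Term S G.ty [] σ} (h : Step P P') :
      Step (.app M P) (.app M P')

/-- The start symbol, as a closed term of ground type. -/
def startTerm : Term S G.ty [] .o := G.start_ty ▸ Term.nt G.start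

/-- The value tree, as the graph of a partial function from positions to symbols: the position `p`
carries `a` when it does so in some term obtained from the start symbol. -/
def valueTree (p : List ℕ) (a : S.sym) : Prop :=
  ∃ t, Relation.ReflTransGen G.Step G.startTerm t ∧ LabelAt t p a

end HORS

/-! ### Alternating parity tree automata -/

/-- An alternating parity tree automaton. The formula `δ(q, a)` is a finite disjunction of
conjunctive clauses, each of them a finite set of pairs (direction, state). -/
structure APT (S : Sig) where
  Q : Type
  [finQ : Finite Q]
  δ : Q → (a : S.sym) → Finset (Finset (Fin (S.ar a) × Q))
  Ω : Q → ℕ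

namespace APT

attribute [instance] APT.finQ

variable {S : Sig} (A : APT S)

/-- `r` is a run-tree of the automaton with initial state `q₀` over the tree `T`. A node of `r`
is labelled by the position of `T` that it visits and by the state in which it does so; the visited
position has to carry a symbol. -/
structure IsRun (T : List ℕ → S.sym → Prop) (q₀ : A.Q) (r : LTree (List ℕ × A.Q)) : Prop where
  root : r.label [] = ([], q₀)
  step : ∀ p ∈ r.nodes, ∃ a, T (r.label p).1 a ∧ ∃ φ ∈ A.δ (r.label p).2 a,
    ∀ l, r.ChildLabel p l ↔ ∃ d q, (d, q) ∈ φ ∧ l = ((r.label p).1 ++ [d.val], q)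

/-- The greatest number that occurs infinitely often in the sequence exists and is even. -/
def ParityWin (s : ℕ → ℕ) : Prop :=
  ∃ c, IsGreatest {d | ∃ᶠ n in Filter.atTop, s n = d} c ∧ Even c

/-- There is an accepting run-tree with initial state `q₀` over `T`. -/
def Accepts (T : List ℕ → S.sym → Prop) (q₀ : A.Q) : Prop :=
  ∃ r, A.IsRun T q₀ r ∧
    ∀ b, r.IsBranch b → ParityWin fun n => A.Ω (r.label (LTree.pref b n)).2

/-- The colours `Ω(Q) ⊎ {ε}`; the neutral colour `ε` is `⊥`. -/
abbrev Col : Type := WithBot (Set.range A.Ω)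

instance : Finite A.Col := inferInstanceAs (Finite (Option (Set.range A.Ω)))

/-- The colour of a state. -/
def col (q : A.Q) : A.Col := ((⟨A.Ω q, q, rfl⟩ : Set.range A.Ω) : WithBot (Set.range A.Ω))

/-- The tuple `α` satisfies the formula `δ(q, a)`. -/
def Sat (q : A.Q) (a : S.sym) (α : Fin (S.ar a) → Finset (A.Col × A.Q)) : Prop :=
  ∃ φ ∈ A.δ q a, ∀ k q', (k, q') ∈ φ → (A.col q', q') ∈ α k

/-! ### The finitary coloured Scott model -/

open FinScottL

/-- The coloured exponential `!□X`. -/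
abbrev Bang (X : FinScottL) : FinScottL := cbObj A.Col X

/-- Morphisms `X ⟶ Y` of the Kleisli category of the coloured exponential. -/
abbrev KHom (X Y : FinScottL) : Type := Bang A X ⟶ Y

/-- The promotion `!□X ⟶ !□!□X ⟶ !□Y` of a Kleisli morphism. -/
def promote {X Y : FinScottL} (R : A.KHom X Y) : Bang A X ⟶ Bang A Y :=
  (cb A.Col).δ.app X ≫ (cb A.Col).map R

/-- The interpretation of simple types. -/
def den : Ty → FinScottL
  | .o => discrete A.Q
  | .arr σ τ => lolli (Bang A (den σ)) (den τ)

/-- The Seely isomorphism: `!□X ⊗ !□Y ≅ !□(X & Y)`. -/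
def seely {X Y : FinScottL} (u : Finset (A.Col × X)) (v : Finset (A.Col × Y)) :
    Finset (A.Col × (X ⊕ Y)) :=
  (u.disjSum v).map (Equiv.prodSumDistrib A.Col X Y).symm.toEmbedding

theorem mem_seely_inl {X Y : FinScottL} {u : Finset (A.Col × X)} {v : Finset (A.Col × Y)}
    {c : A.Col} {x : X} : (c, Sum.inl x) ∈ A.seely u v ↔ (c, x) ∈ u := by
  simp [seely, Finset.mem_map_equiv]

theorem mem_seely_inr {X Y : FinScottL} {u : Finset (A.Col × X)} {v : Finset (A.Col × Y)}
    {c : A.Col} {y : Y} : (c, Sum.inr y) ∈ A.seely u v ↔ (c, y) ∈ v := by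
  simp [seely, Finset.mem_map_equiv]

/-- Currying in the Kleisli category. -/
def curry {X Y Z : FinScottL} (R : A.KHom (prod X Y) Z) : A.KHom Y (lolli (Bang A X) Z) where
  rel (w : Finset (A.Col × Y)) (x : Finset (A.Col × X) × Z) := R.rel (A.seely x.1 w) x.2
  down := by
    rintro w w' ⟨u, z⟩ ⟨u', z'⟩ h hw ⟨hu, hz⟩
    refine R.down h ?_ hz
    rintro ⟨c, x | y⟩ hm
    · obtain ⟨⟨d, x'⟩, h1, h2, h3⟩ := hu (c, x) (A.mem_seely_inl.1 hm)
      exact ⟨(d, Sum.inl x'), A.mem_seely_inl.2 h1, h2, Sum.LiftRel.inl h3⟩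
    · obtain ⟨⟨d, y'⟩, h1, h2, h3⟩ := hw (c, y) (A.mem_seely_inr.1 hm)
      exact ⟨(d, Sum.inr y'), A.mem_seely_inr.2 h1, h2, Sum.LiftRel.inr h3⟩

/-- Application in the Kleisli category: evaluation after `R` and the promotion of `T`, both
applied to the same context. -/
def apply {X Y Z : FinScottL} (R : A.KHom X (lolli (Bang A Y) Z)) (T : A.KHom X Y) :
    A.KHom X Z where
  rel w z := ∃ v : Bang A Y, R.rel w (v, z) ∧ (A.promote T).rel w v
  down := fun ⟨v, h, k⟩ hw hz =>
    ⟨v, R.down h hw ⟨le_rfl, hz⟩, (A.promote T).down k hw le_rfl⟩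

/-- An element `u₁ → ⋯ → uₙ → q` of the interpretation of `o → ⋯ → o → o`, as the tuple of the
`uᵢ` and the state `q`. -/
def spine : ∀ (n : ℕ), A.den (Ty.first n) → (Fin n → Finset (A.Col × A.Q)) × A.Q
  | 0, q => (Fin.elim0, q)
  | n + 1, x => (Fin.cons x.1 (spine n x.2).1, (spine n x.2).2)

theorem spine_le : ∀ (n : ℕ) {x y : A.den (Ty.first n)}, x ≤ y →
    (A.spine n x).2 = (A.spine n y).2 ∧ ∀ k, (A.spine n y).1 k ⊆ (A.spine n x).1 k
  | 0, _, _, h => ⟨h, fun k => k.elim0⟩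
  | n + 1, x, y, h => by
    obtain ⟨h1, h2⟩ := h
    obtain ⟨h3, h4⟩ := spine_le n h2
    refine ⟨h3, Fin.cases ?_ h4⟩
    rintro ⟨c, q⟩ hm
    obtain ⟨⟨d, q'⟩, hm', hc, hq⟩ := h1 (c, q) hm
    obtain rfl : c = d := hc
    obtain rfl : q = q' := hq
    exact hm'

/-- The interpretation of the symbol `a`, in any context. -/
def constDen (X : FinScottL) (a : S.sym) : A.KHom X (A.den (Ty.first (S.ar a))) where
  rel _ x := A.Sat (A.spine _ x).2 a (A.spine _ x).1
  down := by
    rintro u u' x y ⟨φ, hφ, h⟩ _ hxy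
    obtain ⟨h1, h2⟩ := A.spine_le _ hxy
    exact ⟨φ, h1 ▸ hφ, fun k q' hk => h2 k (h k q' hk)⟩

section Terms

variable {N : Type} [Finite N] (ty : N → Ty)

/-- The product of the interpretations of the non-terminals. -/
def denNT : FinScottL := pi fun F => A.den (ty F)

/-- The interpretation of a context: the product of its types and of the non-terminals. -/
def denCtx : List Ty → FinScottL
  | [] => A.denNT ty
  | σ :: Γ => prod (A.den σ) (denCtx Γ)

/-- The projection to a variable of the context. -/
def projVar : ∀ {Γ : List Ty} {σ : Ty}, Var Γ σ → (A.denCtx ty Γ ⟶ A.den σ)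
  | _, _, .zero => fst _ _
  | _, _, .succ x => snd _ _ ≫ projVar x

/-- The projection to a non-terminal. -/
def projNT (F : N) : ∀ Γ : List Ty, A.denCtx ty Γ ⟶ A.den (ty F)
  | [] => proj _ F
  | _ :: Γ => snd _ _ ≫ projNT F Γ

/-- The interpretation of terms. -/
def denTerm {Γ : List Ty} : ∀ {σ : Ty}, Term S ty Γ σ → A.KHom (A.denCtx ty Γ) (A.den σ)
  | _, .const a => A.constDen _ a
  | _, .nt F => (cb A.Col).ε.app _ ≫ A.projNT ty F Γ
  | _, .var x => (cb A.Col).ε.app _ ≫ A.projVar ty x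
  | _, .app M M' => A.apply (denTerm M) (denTerm M')

/-- The interpretation of `λx₁. … λxₙ. t`. -/
def denRule : ∀ {Γ : List Ty} {σ : Ty}, Rule S ty Γ σ → A.KHom (A.denCtx ty Γ) (A.den σ)
  | _, _, .body t => A.denTerm ty t
  | _, _, .lam r => A.curry (denRule r)

end Terms

/-! ### The fixpoint operator -/

/-- `w` is a semantic run-tree of `R` producing `a`. A node of `w` is labelled by an element of
`X ⊎ Y` together with a colour. -/
structure IsSemRun {X Y : FinScottL} (R : tensor (Bang A X) (Bang A Y) ⟶ Y) (a : Y)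
    (w : LTree ((X ⊕ Y) × A.Col)) : Prop where
  root : w.label [] = (Sum.inr a, ⊥)
  leaf : ∀ p ∈ w.nodes, ∀ x, (w.label p).1 = Sum.inl x → ∀ i, p ++ [i] ∉ w.nodes
  step : ∀ p ∈ w.nodes, ∀ b, (w.label p).1 = Sum.inr b →
    ∃ (u : Finset (A.Col × X)) (v : Finset (A.Col × Y)),
      (∀ c x, (c, x) ∈ u ↔ w.ChildLabel p (Sum.inl x, c)) ∧
      (∀ c y, (c, y) ∈ v ↔ w.ChildLabel p (Sum.inr y, c)) ∧ R.rel (u, v) b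

/-- The winning condition on a sequence of colours: some non-neutral colour occurs infinitely
often, and the greatest such colour is even. -/
def ColWin (s : ℕ → A.Col) : Prop :=
  ∃ c : Set.range A.Ω,
    IsGreatest {d : Set.range A.Ω | ∃ᶠ n in Filter.atTop, s n = (d : WithBot (Set.range A.Ω))} c ∧
    Even c.val

/-- The semantic run-tree `w` is winning. -/
def SemWinning {X Y : FinScottL} (w : LTree ((X ⊕ Y) × A.Col)) : Prop :=
  ∀ b, w.IsBranch b → A.ColWin fun n => (w.label (LTree.pref b n)).2

/-- `(c, x)` belongs to `leaves(w)`: some node of `w` is labelled by `x`, and `c` is the greatest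
colour on the path between this node and the root, both included. -/
def IsLeaf {X Y : FinScottL} (w : LTree ((X ⊕ Y) × A.Col)) (c : A.Col) (x : X) : Prop :=
  ∃ p ∈ w.nodes, (w.label p).1 = Sum.inl x ∧ IsGreatest {d | ∃ s, s <+: p ∧ (w.label s).2 = d} c

/-- The fixpoint operator, which transports a morphism `!□X ⊗ !□Y ⟶ Y` to a relation between
`!□X` and `Y`. -/
def fixRel {X Y : FinScottL} (R : tensor (Bang A X) (Bang A Y) ⟶ Y)
    (u : Finset (A.Col × X)) (a : Y) : Prop :=
  ∃ w, A.IsSemRun R a w ∧ (∀ c x, (c, x) ∈ u ↔ A.IsLeaf w c x) ∧ A.SemWinning w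

/-! ### The interpretation of a recursion scheme -/

/-- The morphism `!□⊤ ⊗ !□N ⟶ N` given by the right-hand sides of the scheme, where `N` is the
product of the interpretations of the non-terminals. -/
def ruleHom (G : HORS S) :
    tensor (Bang A top) (Bang A (A.denNT G.ty)) ⟶ A.denNT G.ty where
  rel x y := (tuple fun F => A.denRule G.ty (G.rule F)).rel x.2 y
  down := fun h hx hy => (tuple fun F => A.denRule G.ty (G.rule F)).down h hx.2 hy

/-- A state, as an element of the interpretation of the type `o` of the start symbol. -/
def startElt (G : HORS S) (q : A.Q) : A.den (G.ty G.start) :=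
  G.start_ty.symm ▸ (show A.den .o from q)

/-- The interpretation of the scheme: the component at the start symbol of the fixpoint of its
right-hand sides. -/
def interp (G : HORS S) : Set A.Q :=
  {q | A.fixRel (A.ruleHom G) ∅ ⟨G.start, A.startElt G q⟩}

end APT

end HOMC

/-! Both sides of the equivalence assert a winning strategy in a parity game. They are compared
through a third game, in which a closed term of ground type is evaluated while the automaton chooses
clauses (`IsEval`, `IsWeakEval`). Strategies are coloured graphs all of whose infinite sequences of
edges win (`InfWin`), rather than trees. Edges may then be grouped into paths, since
`exists_edges_of_paths` relates the limit colours.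

On the syntactic side, standardisation (`headValue_of_valueTree`) shows that head reductions compute
the value tree. An accepting run-tree can therefore be played along head reductions, which are
silent moves of colour `⊥`; these cannot go on forever, because a run-tree visits only positions
that carry a symbol. Conversely, a winning evaluation unfolds to an accepting run-tree
(`IsWeakEval.accepts`).

From acceptance to the model, elements of the interpretation are read off a given strategy. By
recursion on the type, `tyAt` describes an argument by all later vertices at which it comes to the
head, each with the greatest colour met on the way. These elements satisfy the interpretations of
terms and rules (`IsEval.denTerm_rel`, `IsEval.denRule_rel`), and the vertices headed by
non-terminals, with paths as edges, form a semantic strategy.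

From the model to acceptance, membership yields derivations, which drive an abstract machine with a
stack of arguments. The main point is that all its infinite plays win (`infWin_move`). Suppose that
one loses, with limit colour `c`. From some point on no colour exceeds `c`, and each configuration
has a level that bounds the wait for the next `c`. In the fixpoint graph, the paths of greatest
colour `c` form a well-founded relation, as an infinite chain would make `c` winning. A logical
predicate `Good` says that a derivation never occurs in the tail of the play when its arguments are
good. Induction along those paths, and on levels inside (`good_nt`), makes non-terminals good;
everything else follows by structural induction, so the tail is empty. -/

namespace HOMC

/-! ### Limits of colour sequences -/

section Limits

variable {C : Type} [LinearOrder C]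

/-- `c` is the greatest colour that occurs infinitely often in `s`. -/
def LimCol (s : ℕ → C) (c : C) : Prop :=
  (∃ᶠ n in Filter.atTop, s n = c) ∧ ∀ᶠ n in Filter.atTop, s n ≤ c

/-- By pigeonhole some colour recurs. The largest recurrent one works, because each of the finitely
many larger colours disappears after some stage. -/
theorem exists_limCol [Finite C] (s : ℕ → C) : ∃ c, LimCol s c := by
  have hne : {c | ∃ᶠ n in Filter.atTop, s n = c}.Nonempty := by
    by_contra h
    rw [Set.not_nonempty_iff_eq_empty, Set.eq_empty_iff_forall_notMem] at h
    have : ∀ᶠ n in Filter.atTop, ∀ c, s n ≠ c :=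
      Filter.eventually_all.2 fun c => Filter.not_frequently.1 (h c)
    obtain ⟨n, hn⟩ := this.exists
    exact hn _ rfl
  obtain ⟨c, hc⟩ := (Set.toFinite {c | ∃ᶠ n in Filter.atTop, s n = c}).exists_maximal hne
  refine ⟨c, hc.1, ?_⟩
  have : ∀ᶠ n in Filter.atTop, ∀ d, c < d → s n ≠ d := by
    refine Filter.eventually_all.2 fun d => ?_
    by_cases hd : ∃ᶠ n in Filter.atTop, s n = d
    · exact Filter.Eventually.of_forall fun n h =>
        absurd (hc.2 hd h.le) (not_le.2 h)
    · exact (Filter.not_frequently.1 hd).mono fun n h _ => h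
  exact this.mono fun n h => not_lt.1 fun hlt => h _ hlt rfl

theorem limCol_shift {s : ℕ → C} {c : C} (k : ℕ) :
    LimCol (fun n => s (n + k)) c ↔ LimCol s c := by
  have h1 : (∃ᶠ n in Filter.atTop, s (n + k) = c) ↔ ∃ᶠ n in Filter.atTop, s n = c := by
    conv_rhs => rw [← Filter.map_add_atTop_eq_nat k, Filter.frequently_map]
  have h2 : (∀ᶠ n in Filter.atTop, s (n + k) ≤ c) ↔ ∀ᶠ n in Filter.atTop, s n ≤ c := by
    conv_rhs => rw [← Filter.map_add_atTop_eq_nat k, Filter.eventually_map]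
  exact and_congr h1 h2

/-- Inserting least colours into a sequence does not change its limit. -/
theorem LimCol.of_subseq [OrderBot C] {s : ℕ → C} {m : ℕ → ℕ} (hm : StrictMono m)
    (hs : ∀ n, n ∉ Set.range m → s n = ⊥) {c : C} (h : LimCol (s ∘ m) c) : LimCol s c := by
  refine ⟨hm.tendsto_atTop.frequently h.1, ?_⟩
  obtain ⟨N, hN⟩ := Filter.eventually_atTop.1 h.2
  refine Filter.eventually_atTop.2 ⟨m N, fun n hn => ?_⟩
  by_cases hr : n ∈ Set.range m
  · obtain ⟨i, rfl⟩ := hr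
    exact hN i (hm.le_iff_le.1 hn)
  · rw [hs n hr]
    exact bot_le

end Limits

namespace APT

variable {S : Sig} (A : APT S)

/-- The greatest colour that occurs infinitely often is an even, non-neutral colour. -/
def Win (s : ℕ → A.Col) : Prop :=
  ∃ c : Set.range A.Ω, Even c.val ∧ LimCol s (c : WithBot (Set.range A.Ω))

/-- The neutral colour lies below all others, so admitting it as a limit makes no difference as soon
as another colour recurs; if none does, both conditions fail. -/
theorem colWin_iff {s : ℕ → A.Col} : A.ColWin s ↔ A.Win s := by
  constructor
  · rintro ⟨c, hc, he⟩
    obtain ⟨d, hd⟩ := exists_limCol s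
    refine ⟨c, he, ?_⟩
    have : d = (c : WithBot (Set.range A.Ω)) := by
      have hcd : ((c : WithBot (Set.range A.Ω)) : A.Col) ≤ d := by
        obtain ⟨n, h1, h2⟩ := (Filter.Frequently.and_eventually hc.1 hd.2).exists
        exact h1 ▸ h2
      refine le_antisymm ?_ hcd
      induction d using WithBot.recBotCoe with
      | bot => exact bot_le
      | coe d => exact WithBot.coe_le_coe.2 (hc.2 hd.1)
    exact this ▸ hd
  · rintro ⟨c, he, hl⟩
    refine ⟨c, ⟨hl.1, fun d hd => ?_⟩, he⟩
    obtain ⟨n, h1, h2⟩ := (Filter.Frequently.and_eventually hd hl.2).exists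
    exact WithBot.coe_le_coe.1 (h1 ▸ h2)

theorem col_eq_coe {q : A.Q} {c : Set.range A.Ω} :
    A.col q = (c : WithBot (Set.range A.Ω)) ↔ A.Ω q = c.val :=
  WithBot.coe_inj.trans Subtype.ext_iff

theorem parityWin_iff {s : ℕ → A.Q} :
    ParityWin (fun n => A.Ω (s n)) ↔ A.Win fun n => A.col (s n) := by
  rw [← colWin_iff]
  constructor
  · rintro ⟨c, ⟨hc, hm⟩, he⟩
    obtain ⟨n, hn⟩ := Filter.Frequently.exists hc
    refine ⟨⟨c, s n, hn⟩, ⟨?_, fun d hd => ?_⟩, he⟩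
    · exact Filter.Frequently.mono hc fun n hn => A.col_eq_coe.2 hn
    · exact hm (Filter.Frequently.mono hd fun n hn => A.col_eq_coe.1 hn)
  · rintro ⟨c, ⟨hc, hm⟩, he⟩
    refine ⟨c, ⟨?_, fun d hd => ?_⟩, he⟩
    · exact Filter.Frequently.mono hc fun n hn => A.col_eq_coe.1 hn
    · obtain ⟨n, hn⟩ := Filter.Frequently.exists hd
      exact @hm ⟨d, s n, hn⟩ (Filter.Frequently.mono hd fun n hn => A.col_eq_coe.2 hn)

theorem win_shift {s : ℕ → A.Col} (k : ℕ) : A.Win (fun n => s (n + k)) ↔ A.Win s := by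
  simp only [Win, limCol_shift]

end APT

/-! ### Graphs with coloured edges -/

section Paths

variable {C X : Type} [LinearOrder C] (E : X → C → X → Prop)

/-- `PathLen E n x c y`: there is a path of length `n + 1` from `x` to `y`, the greatest colour of
which is `c`. -/
inductive PathLen : ℕ → X → C → X → Prop
  | single {x c y} (h : E x c y) : PathLen 0 x c y
  | cons {n x c y d z} (h : E x c y) (p : PathLen n y d z) : PathLen (n + 1) x (max c d) z

/-- There is a non-empty path from `x` to `y`, the greatest colour of which is `c`. -/
def Path (x : X) (c : C) (y : X) : Prop := ∃ n, PathLen E n x c y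

variable {E}

theorem Path.single {x c y} (h : E x c y) : Path E x c y := ⟨0, .single h⟩

theorem Path.cons {x c y d z} (h : E x c y) (p : Path E y d z) : Path E x (max c d) z :=
  p.elim fun n hn => ⟨n + 1, .cons h hn⟩

theorem Path.trans {x c y d z} (p : Path E x c y) (p' : Path E y d z) : Path E x (max c d) z := by
  obtain ⟨n, p⟩ := p
  induction p with
  | single h => exact .cons h p'
  | cons h _ ih => rw [max_assoc]; exact .cons h (ih p')

/-- An infinite sequence of paths unfolds to an infinite sequence of edges with the same limit
colour. -/
theorem exists_edges_of_paths {x : ℕ → X} {c : ℕ → C} (h : ∀ n, Path E (x n) (c n) (x (n + 1))) :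
    ∃ (y : ℕ → X) (e : ℕ → C), (∀ n, E (y n) (e n) (y (n + 1))) ∧
      ∀ a, LimCol e a → LimCol c a := by
  choose len hlen using h
  -- A state records the index of the current path, the current vertex, and the length (one less
  -- than the number of edges) and greatest colour of what remains of that path.
  let Z := {z : ℕ × X × ℕ × C // PathLen E z.2.2.1 z.2.1 z.2.2.2 (x (z.1 + 1))}
  let start (i : ℕ) : Z := ⟨(i, x i, len i, c i), hlen i⟩
  have hnext : ∀ z : Z, ∃ (z' : Z) (e : C), E z.1.2.1 e z'.1.2.1 ∧
      ((z.1.2.2.1 = 0 ∧ z' = start (z.1.1 + 1) ∧ z.1.2.2.2 = e) ∨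
        (z.1.2.2.1 = z'.1.2.2.1 + 1 ∧ z'.1.1 = z.1.1 ∧ z.1.2.2.2 = max e z'.1.2.2.2)) := by
    rintro ⟨⟨i, y, n, d⟩, p⟩
    cases p with
    | single p => exact ⟨start (i + 1), d, p, .inl ⟨rfl, rfl, rfl⟩⟩
    | @cons n _ e z d _ p p' => exact ⟨⟨(i, z, n, d), p'⟩, e, p, .inr ⟨rfl, rfl, rfl⟩⟩
  choose next e hedge hcase using hnext
  let z : ℕ → Z := fun n => next^[n] (start 0)
  have hz : ∀ n, z (n + 1) = next (z n) := fun n => Function.iterate_succ_apply' _ _ _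
  have hle : ∀ n, (z n).1.2.2.2 ≤ c (z n).1.1 := by
    intro n
    induction n with
    | zero => exact le_rfl
    | succ n ih =>
      rw [hz]
      rcases hcase (z n) with ⟨_, h2, _⟩ | ⟨_, h2, h3⟩
      · rw [h2]
      · rw [h2]
        exact (le_max_right _ _).trans (h3 ▸ ih)
  have hele : ∀ n, e (z n) ≤ (z n).1.2.2.2 := by
    intro n
    rcases hcase (z n) with ⟨_, _, h3⟩ | ⟨_, _, h3⟩
    · rw [h3]
    · rw [h3]
      exact le_max_left _ _
  have hend : ∀ l n, (z n).1.2.2.1 = l → ∃ m, n < m ∧ z m = start ((z n).1.1 + 1) := by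
    intro l
    induction l with
    | zero =>
      intro n hn
      rcases hcase (z n) with ⟨_, h2, _⟩ | ⟨h1, _, _⟩
      · exact ⟨n + 1, n.lt_succ_self, (hz n).trans h2⟩
      · omega
    | succ l ih =>
      intro n hn
      rcases hcase (z n) with ⟨h1, _, _⟩ | ⟨h1, h2, _⟩
      · omega
      · obtain ⟨m, hm, he⟩ := ih (n + 1) (by rw [hz]; omega)
        refine ⟨m, by omega, ?_⟩
        rw [he, hz, h2]
  have hstart : ∀ i, ∃ n, i ≤ n ∧ z n = start i := by
    intro i
    induction i with
    | zero => exact ⟨0, le_rfl, rfl⟩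
    | succ i ih =>
      obtain ⟨n, hn, he⟩ := ih
      obtain ⟨m, hm, he'⟩ := hend _ n rfl
      refine ⟨m, by omega, ?_⟩
      rw [he', he]
  -- The colour of what remains of a path is attained on an edge still to come, so a bound on all
  -- later edges bounds it.
  have hbound : ∀ a l n, (z n).1.2.2.1 = l → (∀ m, n ≤ m → e (z m) ≤ a) →
      (z n).1.2.2.2 ≤ a := by
    intro a l
    induction l with
    | zero =>
      intro n hn ha
      rcases hcase (z n) with ⟨_, _, h3⟩ | ⟨h1, _, _⟩
      · exact h3 ▸ ha n le_rfl
      · omega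
    | succ l ih =>
      intro n hn ha
      rcases hcase (z n) with ⟨h1, _, _⟩ | ⟨h1, _, h3⟩
      · omega
      · rw [h3, ← hz]
        exact max_le (ha n le_rfl)
          (ih (n + 1) (by rw [hz]; omega) fun m hm => ha m (by omega))
  have hmono : Monotone fun n => (z n).1.1 := by
    refine monotone_nat_of_le_succ fun n => ?_
    rw [hz]
    rcases hcase (z n) with ⟨_, h2, _⟩ | ⟨_, h2, _⟩
    · rw [h2]
      exact Nat.le_succ _
    · exact h2.ge
  refine ⟨fun n => (z n).1.2.1, fun n => e (z n), fun n => ?_, ?_⟩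
  · dsimp only
    rw [hz]
    exact hedge (z n)
  rintro a ⟨hf, hev⟩
  obtain ⟨N, hN⟩ := Filter.eventually_atTop.1 hev
  -- The `i`-th path starts no earlier than step `i`, so for `i ≥ N` all its edges are bounded by
  -- `a`.
  have hca : ∀ i, N ≤ i → c i ≤ a := by
    intro i hi
    obtain ⟨n, hn, he⟩ := hstart i
    have := hbound a _ n rfl fun m hm => hN m (by omega)
    rwa [he] at this
  refine ⟨Filter.frequently_atTop.2 fun i => ?_, Filter.eventually_atTop.2 ⟨N, hca⟩⟩
  -- A late edge of colour `a` lies on a late path, whose colour is then at least `a`, and at most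
  -- `a` by `hca`.
  obtain ⟨n, _, hn⟩ := hstart (max i N)
  obtain ⟨m, hm, hma⟩ := Filter.frequently_atTop.1 hf n
  have h1 : max i N ≤ (z m).1.1 := by
    have := hmono hm
    simp only [hn] at this
    exact this
  refine ⟨(z m).1.1, (le_max_left _ _).trans h1,
    le_antisymm (hca _ ((le_max_right _ _).trans h1)) ?_⟩
  exact hma ▸ (hele m).trans (hle m)

end Paths

namespace APT

variable {S : Sig} (A : APT S) {X : Type}

/-- All infinite sequences of edges are winning. -/
def InfWin (E : X → A.Col → X → Prop) : Prop :=
  ∀ (x : ℕ → X) (c : ℕ → A.Col), (∀ n, E (x n) (c n) (x (n + 1))) → A.Win c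

-- Winning depends on the limit colour only, which the grouping of edges into paths preserves.
variable {A} in
theorem InfWin.path {E : X → A.Col → X → Prop} (h : A.InfWin E) : A.InfWin (Path E) := by
  intro x c hx
  obtain ⟨y, e, hy, hl⟩ := exists_edges_of_paths hx
  obtain ⟨d, hd, hlim⟩ := h y e hy
  exact ⟨d, hd, hl _ hlim⟩

end APT

/-! ### Unfolding graphs to labelled trees, and branches of labelled trees -/

namespace LTree

variable {X L : Type}

theorem pref_succ (b : ℕ → ℕ) (n : ℕ) : pref b (n + 1) = pref b n ++ [b n] := by
  simp [pref, List.range_succ]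

/-- The vertex that is reached from `x₀` along a sequence of child numbers. -/
def walk (ch : X → List X) (x₀ : X) (p : List ℕ) : Option X :=
  p.foldl (fun o i => o.bind fun y => (ch y)[i]?) (some x₀)

theorem walk_nil (ch : X → List X) (x₀ : X) : walk ch x₀ [] = some x₀ := rfl

theorem walk_concat (ch : X → List X) (x₀ : X) (p : List ℕ) (i : ℕ) :
    walk ch x₀ (p ++ [i]) = (walk ch x₀ p).bind fun y => (ch y)[i]? := by
  simp [walk]

/-- The tree of the finite paths that start in `x₀`, where `ch` lists the children of a vertex. -/
def unfold (ch : X → List X) (lab : X → L) (x₀ : X) : LTree L where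
  nodes := {p | (walk ch x₀ p).isSome}
  root_mem := rfl
  parent_mem p i h := by
    rw [Set.mem_ofPred_eq, walk_concat] at h
    cases hp : walk ch x₀ p with
    | none => simp [hp] at h
    | some y => simp [hp]
  finite_children p := by
    cases hp : walk ch x₀ p with
    | none => simp [walk_concat, hp]
    | some y => simpa [walk_concat, hp] using Set.finite_lt_nat (ch y).length
  label p := lab ((walk ch x₀ p).getD x₀)

variable {ch : X → List X} {lab : X → L} {x₀ : X}

/-- Only the set of labels of the children is tracked, since that is all that both notions of
run-tree constrain. -/
theorem unfold_node {p : List ℕ} (hp : p ∈ (unfold ch lab x₀).nodes) :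
    ∃ x, walk ch x₀ p = some x ∧ (unfold ch lab x₀).label p = lab x ∧
      ∀ l, (unfold ch lab x₀).ChildLabel p l ↔ ∃ y ∈ ch x, lab y = l := by
  obtain ⟨x, hx⟩ := Option.isSome_iff_exists.1 hp
  refine ⟨x, hx, by simp [unfold, hx], fun l => ?_⟩
  constructor
  · rintro ⟨i, hi, rfl⟩
    obtain ⟨y, hy⟩ := Option.isSome_iff_exists.1 hi
    refine ⟨y, ?_, by simp [unfold, hy]⟩
    rw [walk_concat, hx] at hy
    exact List.mem_of_getElem? hy
  · rintro ⟨y, hy, rfl⟩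
    obtain ⟨i, hi⟩ := List.mem_iff_getElem?.1 hy
    have : walk ch x₀ (p ++ [i]) = some y := by rw [walk_concat, hx]; exact hi
    exact ⟨i, by simp [unfold, this], by simp [unfold, this]⟩

theorem unfold_branch {b : ℕ → ℕ} (hb : (unfold ch lab x₀).IsBranch b) :
    ∃ x : ℕ → X, x 0 = x₀ ∧ (∀ n, x (n + 1) ∈ ch (x n)) ∧
      ∀ n, (unfold ch lab x₀).label (pref b n) = lab (x n) := by
  choose x hx using fun n => Option.isSome_iff_exists.1 (hb n)
  refine ⟨x, ?_, fun n => ?_, fun n => by simp [unfold, hx]⟩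
  · exact Option.some_injective _ ((hx 0).symm.trans (walk_nil ch x₀))
  · have := hx (n + 1)
    rw [pref_succ, walk_concat, hx] at this
    exact List.mem_of_getElem? this

theorem mem_of_prefix (t : LTree L) {p p' : List ℕ} (hp : p' ∈ t.nodes) (h : p <+: p') :
    p ∈ t.nodes := by
  obtain ⟨r, rfl⟩ := h
  induction r using List.reverseRecOn with
  | nil => simpa using hp
  | append_singleton r i ih => exact ih (t.parent_mem _ i (by simpa using hp))

/-- A sequence of nodes, each of them a child of the previous one, is the end of a branch. -/
theorem exists_branch (t : LTree L) {x : ℕ → List ℕ} (hx : ∀ n, x n ∈ t.nodes)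
    (h : ∀ n, ∃ i, x (n + 1) = x n ++ [i]) :
    ∃ b, t.IsBranch b ∧ ∀ n, pref b (n + (x 0).length) = x n := by
  have hlen : ∀ n, (x n).length = n + (x 0).length := by
    intro n
    induction n with
    | zero => simp
    | succ n ih =>
      obtain ⟨i, hi⟩ := h n
      simp only [hi, List.length_append, ih, List.length_singleton]
      omega
  have hpre : ∀ m n, m ≤ n → x m <+: x n := by
    intro m n hmn
    induction n, hmn using Nat.le_induction with
    | base => exact List.prefix_rfl
    | succ n _ ih =>
      obtain ⟨i, hi⟩ := h n
      exact ih.trans (hi ▸ List.prefix_append _ _)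
  -- The `k`-th direction is read off `x (k + 1)`, whose length exceeds `k`; the default `0` is
  -- never used.
  have hpref : ∀ n, pref (fun k => (x (k + 1)).getD k 0) (n + (x 0).length) = x n := by
    intro n
    refine List.ext_getElem (by simp [pref, hlen n]) fun k h1 h2 => ?_
    have h3 : k < (x (k + 1)).length := by rw [hlen]; omega
    simp only [pref, List.getElem_map, List.getElem_range]
    rw [List.getD_eq_getElem _ _ h3]
    rcases le_total (k + 1) n with hk | hk
    · exact (hpre _ _ hk).getElem h3
    · exact ((hpre _ _ hk).getElem h2).symm
  -- Prefixes shorter than `x 0` are not among the given nodes; in general the prefix of length `m`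
  -- is a node because it is a prefix of `x m`.
  refine ⟨_, fun m => t.mem_of_prefix (hx m) ?_, hpref⟩
  rw [← hpref m]
  refine ⟨(List.range' m (x 0).length).map fun k => (x (k + 1)).getD k 0, ?_⟩
  rw [pref, pref, ← List.map_append, List.range_eq_range', List.range_eq_range']
  congr 1
  simpa using List.range'_append (s := 0) (m := m) (n := (x 0).length) (step := 1)

end LTree

/-! ### Head reduction -/

section Head

variable {S : Sig} {N : Type} {ty : N → Ty}

/-- The decomposition of a closed term of ground type into its head and its arguments. -/
inductive Spine (S : Sig) {N : Type} (ty : N → Ty) : Type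
  | sym (a : S.sym) (as : Args S ty (Ty.first (S.ar a)))
  | nt (F : N) (as : Args S ty (ty F))

/-- The spine of the term `M t₁ … tₙ`. -/
def Term.spine : ∀ {σ : Ty}, Term S ty [] σ → Args S ty σ → Spine S ty
  | _, .const a, as => .sym a as
  | _, .nt F, as => .nt F as
  | _, .app M P, as => M.spine (.cons P as)

theorem Args.spine_apply : ∀ {σ : Ty} (as : Args S ty σ) (M : Term S ty [] σ),
    (as.apply M).spine .nil = M.spine as
  | _, .nil, _ => rfl
  | _, .cons P as, M => as.spine_apply (.app M P)

/-- An equation between values of `Args.apply` cannot be analysed by cases; `Term.spine` recovers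
the head and the arguments from such a value. -/
theorem Args.apply_nt_inj {F F' : N} {as : Args S ty (ty F)} {as' : Args S ty (ty F')}
    (h : as.apply (.nt F) = as'.apply (.nt F')) : Spine.nt F as = Spine.nt F' as' := by
  have := congrArg (fun t => Term.spine t .nil) h
  simpa only [Args.spine_apply, Term.spine] using this

theorem Args.apply_const_inj {a a' : S.sym} {as : Args S ty (Ty.first (S.ar a))}
    {as' : Args S ty (Ty.first (S.ar a'))}
    (h : as.apply (.const a) = as'.apply (.const a')) : Spine.sym a as = Spine.sym a' as' := by
  have := congrArg (fun t => Term.spine t .nil) h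
  simpa only [Args.spine_apply, Term.spine] using this

theorem Args.apply_const_ne_nt {a : S.sym} {F : N} {as : Args S ty (Ty.first (S.ar a))}
    {as' : Args S ty (ty F)} : as.apply (.const a) ≠ as'.apply (.nt F) := by
  intro h
  have := congrArg (fun t => Term.spine t .nil) h
  simp only [Args.spine_apply, Term.spine] at this
  cases this

/-- The first argument. -/
def Args.head {σ τ : Ty} : Args S ty (.arr σ τ) → Term S ty [] σ
  | .cons t _ => t

/-- The arguments after the first one. -/
def Args.tail {σ τ : Ty} : Args S ty (.arr σ τ) → Args S ty τ
  | .cons _ as => as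

theorem Args.eq_nil : ∀ as : Args S ty .o, as = .nil
  | .nil => rfl

/-- The arguments of a symbol of arity `n`, as a family. -/
def Args.get : ∀ {n : ℕ}, Args S ty (Ty.first n) → Fin n → Term S ty [] .o
  | 0, _ => Fin.elim0
  | _ + 1, as => Fin.cons as.head (Args.get as.tail)

theorem Args.appN_get : ∀ {n : ℕ} (as : Args S ty (Ty.first n)) (M : Term S ty [] (Ty.first n)),
    Term.appN M as.get = as.apply M
  | 0, as, M => by rw [as.eq_nil]; rfl
  | n + 1, .cons t as, M => as.appN_get (.app M t)

theorem Args.exists_get : ∀ {n : ℕ} (ts : Fin n → Term S ty [] .o),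
    ∃ as : Args S ty (Ty.first n), as.get = ts
  | 0, ts => ⟨.nil, funext fun i => i.elim0⟩
  | n + 1, ts => by
    obtain ⟨as, h⟩ := Args.exists_get fun i => ts i.succ
    refine ⟨.cons (ts 0) as, funext fun i => ?_⟩
    refine Fin.cases rfl (fun j => ?_) i
    exact congrFun h j

end Head

namespace HORS

variable {S : Sig} (G : HORS S)

/-- `HeadValue t p a`: the position `p` of the value tree of `t` carries `a`, as witnessed by head
reductions only. -/
inductive HeadValue : Term S G.ty [] .o → List ℕ → S.sym → Prop
  | red (F : G.N) (as : Args S G.ty (G.ty F)) {p a}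
      (h : HeadValue ((G.rule F).inst Env.nil as) p a) : HeadValue (as.apply (.nt F)) p a
  | root (a : S.sym) (as : Args S G.ty (Ty.first (S.ar a))) : HeadValue (as.apply (.const a)) [] a
  | child (a : S.sym) (as : Args S G.ty (Ty.first (S.ar a))) (i : Fin (S.ar a)) {p b}
      (h : HeadValue (as.get i) p b) : HeadValue (as.apply (.const a)) (i.val :: p) b

theorem headValue_of_labelAt {t : Term S G.ty [] .o} {p : List ℕ} {a : S.sym}
    (h : LabelAt t p a) : G.HeadValue t p a := by
  induction h with
  | root a ts =>
    obtain ⟨as, rfl⟩ := Args.exists_get ts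
    rw [Args.appN_get]
    exact .root a as
  | child a ts i p b _ ih =>
    obtain ⟨as, rfl⟩ := Args.exists_get ts
    rw [Args.appN_get]
    exact .child a as i ih

/-- `Std t t'`: the term `t` reduces to `t'` by head reductions of subterms of ground type, followed
by reductions of this kind in the immediate subterms. -/
inductive Std : ∀ {σ : Ty}, Term S G.ty [] σ → Term S G.ty [] σ → Prop
  | head (F : G.N) (as : Args S G.ty (G.ty F)) {t'} (h : Std ((G.rule F).inst Env.nil as) t') :
      Std (as.apply (.nt F)) t'
  | const (a : S.sym) : Std (.const a) (.const a)
  | nt (F : G.N) : Std (.nt F) (.nt F)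
  | app {σ τ : Ty} {M M' : Term S G.ty [] (.arr σ τ)} {P P' : Term S G.ty [] σ} (h : Std M M')
      (k : Std P P') : Std (.app M P) (.app M' P')

theorem Std.refl : ∀ {σ : Ty} (t : Term S G.ty [] σ), G.Std t t
  | _, .const a => .const a
  | _, .nt F => .nt F
  | _, .app M P => .app (Std.refl M) (Std.refl P)

theorem std_of_step {σ : Ty} {t t' : Term S G.ty [] σ} (h : G.Step t t') : G.Std t t' := by
  induction h with
  | rule F as => exact .head F as (Std.refl G _)
  | left P _ ih => exact .app ih (Std.refl G P)
  | right M _ ih => exact .app (Std.refl G M) ih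

theorem Std.subst {Γ : List Ty} {ρ ρ' : Env S G.ty Γ} (hρ : ∀ σ x, G.Std (ρ σ x) (ρ' σ x)) :
    ∀ {σ : Ty} (M : Term S G.ty Γ σ), G.Std (M.subst ρ) (M.subst ρ')
  | _, .const a => .const a
  | _, .nt F => .nt F
  | _, .var x => hρ _ x
  | _, .app M P => .app (Std.subst hρ M) (Std.subst hρ P)

/-- Argumentwise `Std`. -/
inductive StdArgs : ∀ {σ : Ty}, Args S G.ty σ → Args S G.ty σ → Prop
  | nil : StdArgs .nil .nil
  | cons {σ τ : Ty} {t t' : Term S G.ty [] σ} {as as' : Args S G.ty τ} (h : G.Std t t')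
      (k : StdArgs as as') : StdArgs (.cons t as) (.cons t' as')

/-- This allows a head step to be moved in front of reductions inside the arguments. -/
theorem Std.inst {Γ : List Ty} {σ : Ty} (r : Rule S G.ty Γ σ) {ρ ρ' : Env S G.ty Γ}
    (hρ : ∀ σ x, G.Std (ρ σ x) (ρ' σ x)) {as as' : Args S G.ty σ} (h : G.StdArgs as as') :
    G.Std (r.inst ρ as) (r.inst ρ' as') := by
  induction r with
  | body t => cases h; exact Std.subst G hρ t
  | lam r ih =>
    cases h with
    | cons h k =>
      refine ih (fun σ x => ?_) k
      cases x with
      | zero => exact h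
      | succ x => exact hρ _ x

theorem StdArgs.get : ∀ {n : ℕ} {as as' : Args S G.ty (Ty.first n)}, G.StdArgs as as' →
    ∀ i, G.Std (as.get i) (as'.get i)
  | 0, _, _, _, i => i.elim0
  | _ + 1, _, _, .cons h k, i => Fin.cases h (StdArgs.get k) i

end HORS

/-! ### Standardisation of reductions -/

namespace HORS

variable {S : Sig} (G : HORS S)

/-- The relation `Std` at ground type, in terms of heads and arguments. -/
inductive StdSpine : Term S G.ty [] .o → Term S G.ty [] .o → Prop
  | head (F : G.N) (as : Args S G.ty (G.ty F)) {t'}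
      (h : StdSpine ((G.rule F).inst Env.nil as) t') : StdSpine (as.apply (.nt F)) t'
  | sym (a : S.sym) {as as' : Args S G.ty (Ty.first (S.ar a))} (h : G.StdArgs as as') :
      StdSpine (as.apply (.const a)) (as'.apply (.const a))
  | nt (F : G.N) {as as' : Args S G.ty (G.ty F)} (h : G.StdArgs as as') :
      StdSpine (as.apply (.nt F)) (as'.apply (.nt F))

/-- Arguments accumulate on the way down through applications. A head step occurs only at ground
type, where no arguments are pending. -/
theorem Std.stdSpine {σ : Ty} {M M' : Term S G.ty [] σ} (h : G.Std M M') :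
    ∀ {as as' : Args S G.ty σ}, G.StdArgs as as' → G.StdSpine (as.apply M) (as'.apply M') := by
  induction h with
  | head F as _ ih =>
    intro bs bs' hb
    cases hb
    exact .head F as (ih .nil)
  | const a => exact fun hb => .sym a hb
  | nt F => exact fun hb => .nt F hb
  | app _ k ih _ => exact fun hb => ih (.cons k hb)

/-- The inner induction strips the head steps that lead from `t` towards `t'`. Once they are
exhausted, both terms have the same head and related arguments, and the outer induction hypothesis
applies to the unfolded term or to the subterm. -/
theorem HeadValue.of_stdSpine {t' : Term S G.ty [] .o} {p : List ℕ} {a : S.sym}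
    (h : G.HeadValue t' p a) : ∀ {t}, G.StdSpine t t' → G.HeadValue t p a := by
  induction h with
  | red F as _ ih =>
    intro t ht
    generalize ht' : as.apply (.nt F) = t' at ht
    induction ht with
    | head F' bs _ ih' => exact .red F' bs (ih' ht')
    | sym => exact (Args.apply_const_ne_nt ht'.symm).elim
    | nt F' hbs =>
      cases Args.apply_nt_inj ht'
      exact .red _ _ (ih (Std.stdSpine G (Std.inst G _ (fun _ (x : Var [] _) => nomatch x) hbs) .nil))
  | root a as =>
    intro t ht
    generalize ht' : as.apply (.const a) = t' at ht
    induction ht with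
    | head F' bs _ ih' => exact .red F' bs (ih' ht')
    | sym a' h =>
      cases Args.apply_const_inj ht'
      exact .root _ _
    | nt => exact (Args.apply_const_ne_nt ht').elim
  | child a as i _ ih =>
    intro t ht
    generalize ht' : as.apply (.const a) = t' at ht
    induction ht with
    | head F' bs _ ih' => exact .red F' bs (ih' ht')
    | sym a' h =>
      cases Args.apply_const_inj ht'
      exact .child _ _ _ (ih (Std.stdSpine G (StdArgs.get G h i) .nil))
    | nt => exact (Args.apply_const_ne_nt ht').elim

/-- Head reductions suffice to compute the value tree. -/
theorem headValue_of_valueTree {p : List ℕ} {a : S.sym} (h : G.valueTree p a) :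
    G.HeadValue G.startTerm p a := by
  obtain ⟨t, hr, hl⟩ := h
  generalize G.startTerm = s at hr
  induction hr using Relation.ReflTransGen.head_induction_on with
  | refl => exact G.headValue_of_labelAt hl
  | head hs _ ih => exact ih.of_stdSpine G (Std.stdSpine G (G.std_of_step hs) .nil)

variable {G}

theorem HeadValue.nt_inv {F : G.N} {as : Args S G.ty (G.ty F)} {p : List ℕ} {a : S.sym}
    (h : G.HeadValue (as.apply (.nt F)) p a) : G.HeadValue ((G.rule F).inst Env.nil as) p a := by
  generalize ht : as.apply (.nt F) = t at h
  cases h with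
  | red F' as' h => cases Args.apply_nt_inj ht; exact h
  | root => exact (Args.apply_const_ne_nt ht.symm).elim
  | child => exact (Args.apply_const_ne_nt ht.symm).elim

theorem HeadValue.root_inv {b : S.sym} {as : Args S G.ty (Ty.first (S.ar b))} {a : S.sym}
    (h : G.HeadValue (as.apply (.const b)) [] a) : b = a := by
  generalize ht : as.apply (.const b) = t at h
  cases h with
  | red => exact (Args.apply_const_ne_nt ht).elim
  | root => cases Args.apply_const_inj ht; rfl

theorem HeadValue.child_inv {b : S.sym} {as : Args S G.ty (Ty.first (S.ar b))} {a : S.sym}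
    {i : Fin (S.ar b)} {p : List ℕ} (h : G.HeadValue (as.apply (.const b)) (i.val :: p) a) :
    G.HeadValue (as.get i) p a := by
  generalize ht : as.apply (.const b) = t at h
  generalize hp : i.val :: p = p' at h
  cases h with
  | red => exact (Args.apply_const_ne_nt ht).elim
  | root => cases hp
  | child a' as' j h =>
    cases Args.apply_const_inj ht
    obtain ⟨h1, rfl⟩ := List.cons.inj hp
    rw [Fin.ext h1]
    exact h

/-- There is no infinite head reduction from a term whose value tree is defined at the root. -/
theorem HeadValue.not_infinite {t : Term S G.ty [] .o} {p : List ℕ} {a : S.sym}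
    (h : G.HeadValue t p a) (x : ℕ → Term S G.ty [] .o) (hx : x 0 = t)
    (hs : ∀ n, ∃ F as, x n = Args.apply (.nt F) as ∧ x (n + 1) = (G.rule F).inst Env.nil as) :
    False := by
  induction h generalizing x with
  | red F as _ ih =>
    refine ih (fun n => x (n + 1)) ?_ fun n => hs (n + 1)
    obtain ⟨F', as', h1, h2⟩ := hs 0
    rw [hx] at h1
    cases Args.apply_nt_inj h1
    exact h2
  | root a as =>
    obtain ⟨F', as', h1, h2⟩ := hs 0
    exact Args.apply_const_ne_nt (hx.symm.trans h1)
  | child a as =>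
    obtain ⟨F', as', h1, h2⟩ := hs 0
    exact Args.apply_const_ne_nt (hx.symm.trans h1)

/-! ### Subterms below symbols of the alphabet -/

variable (G)

/-- `SubAt T p t`: the position `p` of `T` is reached through symbols of the alphabet only, and `t`
is the subterm at this position. -/
inductive SubAt : Term S G.ty [] .o → List ℕ → Term S G.ty [] .o → Prop
  | nil (t) : SubAt t [] t
  | cons (a : S.sym) (as : Args S G.ty (Ty.first (S.ar a))) (i : Fin (S.ar a)) {p t}
      (h : SubAt (as.get i) p t) : SubAt (as.apply (.const a)) (i.val :: p) t

variable {G}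

theorem SubAt.labelAt {T : Term S G.ty [] .o} {p : List ℕ} {a : S.sym}
    {as : Args S G.ty (Ty.first (S.ar a))} (h : G.SubAt T p (as.apply (.const a))) :
    LabelAt T p a := by
  generalize ht : as.apply (.const a) = t at h
  induction h with
  | nil t =>
    rw [← ht, ← Args.appN_get]
    exact .root a _
  | cons b bs i _ ih =>
    rw [← Args.appN_get]
    exact .child b _ i _ _ (ih ht)

theorem SubAt.concat {T : Term S G.ty [] .o} {p : List ℕ} {a : S.sym}
    {as : Args S G.ty (Ty.first (S.ar a))} (h : G.SubAt T p (as.apply (.const a)))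
    (i : Fin (S.ar a)) : G.SubAt T (p ++ [i.val]) (as.get i) := by
  generalize ht : as.apply (.const a) = t at h
  induction h with
  | nil t =>
    rw [← ht]
    exact .cons a as i (.nil _)
  | cons b bs j _ ih => exact .cons b bs j (ih ht)

theorem reduces_apply : ∀ {σ : Ty} (as : Args S G.ty σ) {M M' : Term S G.ty [] σ},
    Relation.ReflTransGen G.Step M M' → Relation.ReflTransGen G.Step (as.apply M) (as.apply M')
  | _, .nil, _, _, h => h
  | _, .cons P as, _, _, h =>
    reduces_apply as (h.lift (Term.app · P) fun _ _ h => Step.left P h)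

/-- `M` stands for a symbol already applied to some arguments, so that the induction on the number
of remaining ones goes through. -/
theorem reduces_get : ∀ {n : ℕ} (as : Args S G.ty (Ty.first n)) (M : Term S G.ty [] (Ty.first n))
    (i : Fin n) {u : Term S G.ty [] .o}, Relation.ReflTransGen G.Step (as.get i) u →
    ∃ as' : Args S G.ty (Ty.first n),
      Relation.ReflTransGen G.Step (as.apply M) (as'.apply M) ∧ as'.get i = u
  | 0, _, _, i, _, _ => i.elim0
  | n + 1, .cons t as, M, i, u, h => by
    induction i using Fin.cases with
    | zero =>
      exact ⟨.cons u as, reduces_apply as (h.lift (Term.app M) fun _ _ h => Step.right M h), rfl⟩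
    | succ i =>
      obtain ⟨as', h1, h2⟩ := reduces_get as (.app M t) i h
      exact ⟨.cons t as', h1, h2⟩

/-- Reducing inside an argument of a symbol keeps that symbol at the head, so the position stays
reachable. -/
theorem SubAt.reduces {T : Term S G.ty [] .o} {p : List ℕ} {t t' : Term S G.ty [] .o}
    (h : G.SubAt T p t) (hr : Relation.ReflTransGen G.Step t t') :
    ∃ T', Relation.ReflTransGen G.Step T T' ∧ G.SubAt T' p t' := by
  induction h with
  | nil t => exact ⟨t', hr, .nil _⟩
  | cons a as i _ ih =>
    obtain ⟨u, h1, h2⟩ := ih hr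
    obtain ⟨as', h3, rfl⟩ := reduces_get as (.const a) i h1
    exact ⟨_, h3, .cons a as' i h2⟩

end HORS

/-! ### Acceptance games on closed terms -/

namespace APT

variable {S : Sig} (A : APT S) (G : HORS S)

/-- A winning strategy in the acceptance game that is played along head reductions: `term` and `st`
give the closed term and the state at a vertex. -/
structure IsEval {X : Type} (term : X → Term S G.ty [] .o) (st : X → A.Q)
    (E : X → A.Col → X → Prop) : Prop where
  red : ∀ x F as, term x = Args.apply (.nt F) as →
    ∃ y, E x ⊥ y ∧ term y = (G.rule F).inst Env.nil as ∧ st y = st x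
  sym : ∀ x a as, term x = Args.apply (.const a) as →
    ∃ φ ∈ A.δ (st x) a, ∀ d q, (d, q) ∈ φ → ∃ y, E x (A.col q) y ∧ term y = as.get d ∧ st y = q
  win : A.InfWin E

/-- A winning strategy in the acceptance game with silent moves, during which the term may be
reduced in an arbitrary way. -/
structure IsWeakEval {X : Type} (term : X → Term S G.ty [] .o) (st : X → A.Q)
    (E : X → A.Col → X → Prop) : Prop where
  step : ∀ x,
    (∃ y, E x ⊥ y ∧ Relation.ReflTransGen G.Step (term x) (term y) ∧ st y = st x) ∨
    ∃ a as, term x = Args.apply (.const a) as ∧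
      ∃ φ ∈ A.δ (st x) a, ∀ d q, (d, q) ∈ φ →
        ∃ y, E x (A.col q) y ∧ term y = as.get d ∧ st y = q
  win : A.InfWin E

variable {A G}

theorem not_win_bot : ¬ A.Win fun _ => ⊥ := by
  rintro ⟨c, _, h, _⟩
  obtain ⟨n, hn⟩ := h.exists
  exact WithBot.bot_ne_coe hn

/-- Silent moves end at a term that is headed by a symbol. -/
theorem IsWeakEval.exists_sym {X : Type} {term : X → Term S G.ty [] .o} {st : X → A.Q}
    {E : X → A.Col → X → Prop} (h : A.IsWeakEval G term st E) (x : X) :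
    ∃ a as, Relation.ReflTransGen G.Step (term x) (Args.apply (.const a) as) ∧
      ∃ φ ∈ A.δ (st x) a, ∀ d q, (d, q) ∈ φ →
        ∃ y, Path E x (A.col q) y ∧ term y = as.get d ∧ st y = q := by
  by_contra hx
  -- A failure at `x` forces a silent move to a vertex that fails again; iteration gives an infinite
  -- silent play, which is not winning.
  let P : X → Prop := fun x => ¬ ∃ a as,
    Relation.ReflTransGen G.Step (term x) (Args.apply (.const a) as) ∧
      ∃ φ ∈ A.δ (st x) a, ∀ d q, (d, q) ∈ φ →
        ∃ y, Path E x (A.col q) y ∧ term y = as.get d ∧ st y = q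
  have hnext : ∀ x : {x // P x}, ∃ y : {x // P x}, E x.1 ⊥ y.1 := by
    rintro ⟨x, hx⟩
    rcases h.step x with ⟨y, hE, hr, hst⟩ | ⟨a, as, ht, φ, hφ, hy⟩
    · refine ⟨⟨y, ?_⟩, hE⟩
      rintro ⟨a, as, hr', φ, hφ, hy⟩
      refine hx ⟨a, as, hr.trans hr', φ, hst ▸ hφ, fun d q hdq => ?_⟩
      obtain ⟨z, hz, hz'⟩ := hy d q hdq
      have := Path.cons hE hz
      rw [max_eq_right bot_le] at this
      exact ⟨z, this, hz'⟩
    · refine (hx ⟨a, as, ht ▸ .refl, φ, hφ, fun d q hdq => ?_⟩).elim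
      obtain ⟨z, hz, hz'⟩ := hy d q hdq
      exact ⟨z, .single hz, hz'⟩
  choose next hE using hnext
  refine not_win_bot (h.win (fun n => (next^[n] ⟨x, hx⟩).1) _ fun n => ?_)
  rw [Function.iterate_succ_apply']
  exact hE _

/-- The run-tree is unfolded from pairs of a vertex and a position, with the invariant that the term
of the vertex occurs at that position in some reduct of the start symbol. By `IsWeakEval.exists_sym`
the term can be reduced in place until a symbol appears, which is then a label of the value tree. -/
theorem IsWeakEval.accepts {X : Type} {term : X → Term S G.ty [] .o} {st : X → A.Q}
    {E : X → A.Col → X → Prop} (h : A.IsWeakEval G term st E) {x₀ : X}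
    (h₀ : term x₀ = G.startTerm) : A.Accepts G.valueTree (st x₀) := by
  choose a as hr φ hφ ch hE hterm hst using h.exists_sym
  let Y := {y : X × List ℕ // ∃ T, Relation.ReflTransGen G.Step G.startTerm T ∧
    G.SubAt T y.2 (term y.1)}
  have hroot : ∃ T, Relation.ReflTransGen G.Step G.startTerm T ∧ G.SubAt T [] (term x₀) :=
    ⟨_, .refl, h₀ ▸ .nil _⟩
  have hsub : ∀ y : Y, ∃ T, Relation.ReflTransGen G.Step G.startTerm T ∧
      G.SubAt T y.1.2 (Args.apply (.const (a y.1.1)) (as y.1.1)) := by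
    rintro ⟨⟨x, p⟩, T, hT, hs⟩
    obtain ⟨T', h1, h2⟩ := hs.reduces (hr x)
    exact ⟨T', hT.trans h1, h2⟩
  let chY : Y → List Y := fun y => (φ y.1.1).toList.attach.map fun z =>
    ⟨(ch y.1.1 z.1.1 z.1.2 (Finset.mem_toList.1 z.2), y.1.2 ++ [z.1.1.val]), by
      obtain ⟨T, hT, hs⟩ := hsub y
      refine ⟨T, hT, ?_⟩
      dsimp only
      rw [hterm]
      exact hs.concat _⟩
  have hmem : ∀ y z, z ∈ chY y ↔ ∃ d q, ∃ hdq : (d, q) ∈ φ y.1.1,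
      z.1 = (ch y.1.1 d q hdq, y.1.2 ++ [d.val]) := by
    intro y z
    simp only [chY, List.mem_map, List.mem_attach, true_and]
    constructor
    · rintro ⟨w, rfl⟩
      exact ⟨w.1.1, w.1.2, Finset.mem_toList.1 w.2, rfl⟩
    · rintro ⟨d, q, hdq, hz⟩
      exact ⟨⟨(d, q), Finset.mem_toList.2 hdq⟩, Subtype.ext hz.symm⟩
  refine ⟨LTree.unfold chY (fun y => (y.1.2, st y.1.1)) ⟨(x₀, []), hroot⟩, ⟨rfl, ?_⟩, ?_⟩
  · intro p hp
    obtain ⟨y, _, hl, hc⟩ := LTree.unfold_node hp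
    obtain ⟨T, hT, hs⟩ := hsub y
    rw [hl]
    refine ⟨a y.1.1, ⟨T, hT, hs.labelAt⟩, φ y.1.1, hφ y.1.1, fun l => (hc l).trans ?_⟩
    constructor
    · rintro ⟨z, hz, rfl⟩
      obtain ⟨d, q, hdq, hz⟩ := (hmem y z).1 hz
      refine ⟨d, q, hdq, ?_⟩
      dsimp only
      rw [hz, hst]
    · rintro ⟨d, q, hdq, rfl⟩
      have : ∃ z : Y, z.1 = (ch y.1.1 d q hdq, y.1.2 ++ [d.val]) := by
        refine ⟨⟨_, T, hT, ?_⟩, rfl⟩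
        dsimp only
        rw [hterm]
        exact hs.concat _
      obtain ⟨z, hz⟩ := this
      refine ⟨z, (hmem y z).2 ⟨d, q, hdq, hz⟩, ?_⟩
      rw [hz, hst]
  · intro b hb
    obtain ⟨y, _, hy, hl⟩ := LTree.unfold_branch hb
    simp only [hl]
    -- The initial state is the target of no move; dropping it aligns the states with the colours of
    -- the paths that lead to them.
    rw [A.parityWin_iff (s := fun n => st (y n).1.1), ← A.win_shift 1]
    refine h.win.path (fun n => (y n).1.1) _ fun n => ?_
    obtain ⟨d, q, hdq, hz⟩ := (hmem _ _).1 (hy n)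
    rw [hz, hst]
    exact hE _ _ _ hdq

/-- An accepting run-tree provides a winning strategy along head reductions. -/
theorem exists_isEval_of_accepts {q₀ : A.Q} (h : A.Accepts G.valueTree q₀) :
    ∃ (X : Type) (term : X → Term S G.ty [] .o) (st : X → A.Q) (E : X → A.Col → X → Prop) (x₀ : X),
      A.IsEval G term st E ∧ term x₀ = G.startTerm ∧ st x₀ = q₀ := by
  obtain ⟨r, hr, hw⟩ := h
  -- A vertex pairs a node of the run-tree with a term whose head reductions produce at least the
  -- subtree of the value tree at the visited position. This one implication suffices.
  let X := {x : List ℕ × Term S G.ty [] .o // x.1 ∈ r.nodes ∧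
    ∀ p b, G.valueTree ((r.label x.1).1 ++ p) b → G.HeadValue x.2 p b}
  let E : X → A.Col → X → Prop := fun x c y =>
    (c = ⊥ ∧ y.1.1 = x.1.1 ∧ ∃ F as, x.1.2 = Args.apply (.nt F) as ∧
      y.1.2 = (G.rule F).inst Env.nil as) ∨
    ∃ i, y.1.1 = x.1.1 ++ [i] ∧ c = A.col (r.label y.1.1).2
  refine ⟨X, fun x => x.1.2, fun x => (r.label x.1.1).2, E,
    ⟨([], G.startTerm), r.root_mem, fun p b hp => ?_⟩, ⟨?_, ?_, ?_⟩, rfl, ?_⟩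
  · rw [hr.root] at hp
    exact G.headValue_of_valueTree hp
  · rintro ⟨⟨p, t⟩, hp, ht⟩ F as rfl
    exact ⟨⟨(p, (G.rule F).inst Env.nil as), hp, fun p b hb => (ht p b hb).nt_inv⟩,
      .inl ⟨rfl, rfl, F, as, rfl, rfl⟩, rfl, rfl⟩
  · rintro ⟨⟨p, t⟩, hp, ht⟩ a as rfl
    obtain ⟨a', ha, φ, hφ, hc⟩ := hr.step p hp
    obtain rfl := (ht [] a' (by simpa using ha)).root_inv
    refine ⟨φ, hφ, fun d q hdq => ?_⟩
    obtain ⟨i, hi, hl⟩ := (hc _).2 ⟨d, q, hdq, rfl⟩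
    refine ⟨⟨(p ++ [i], as.get d), hi, fun p' b hb => ?_⟩, .inr ⟨i, rfl, by rw [hl]⟩, rfl,
      by rw [hl]⟩
    refine (ht (d.val :: p') b ?_).child_inv
    rw [hl] at hb
    simpa using hb
  · intro x c hx
    -- The moves to a child in the run-tree; all others are silent head reductions.
    let M : Set ℕ := {n | ∃ i, (x (n + 1)).1.1 = (x n).1.1 ++ [i] ∧
      c n = A.col (r.label (x (n + 1)).1.1).2}
    have hnM : ∀ n, n ∉ M → c n = ⊥ ∧ (x (n + 1)).1.1 = (x n).1.1 ∧
        ∃ F as, (x n).1.2 = Args.apply (.nt F) as ∧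
          (x (n + 1)).1.2 = (G.rule F).inst Env.nil as := fun n hn =>
      (hx n).resolve_right hn
    -- Otherwise some term would have an infinite head reduction, although the position visited
    -- carries a symbol.
    have hM : M.Infinite := by
      refine Set.infinite_of_not_bddAbove ?_
      rintro ⟨N, hN⟩
      have hlt : ∀ n, n + (N + 1) ∉ M := fun n hn => by
        have := hN hn
        omega
      obtain ⟨a, ha, _⟩ := hr.step _ (x (N + 1)).2.1
      refine ((x (N + 1)).2.2 [] a (by simpa using ha)).not_infinite
        (fun n => (x (n + (N + 1))).1.2) (by simp) fun n => ?_
      have := (hnM _ (hlt n)).2.2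
      rwa [show n + (N + 1) + 1 = n + 1 + (N + 1) by omega] at this
    let m : ℕ → ℕ := Nat.nth (· ∈ M)
    have hm : StrictMono m := Nat.nth_strictMono hM
    have hrange : Set.range m = M := Nat.range_nth_of_infinite hM
    have hmM : ∀ k, m k ∈ M := fun k => hrange ▸ Set.mem_range_self k
    -- The node of the run-tree does not change between consecutive elements of `M`.
    have hconst : ∀ k n, m k + 1 ≤ n → n ≤ m (k + 1) → (x n).1.1 = (x (m k + 1)).1.1 := by
      intro k n hn
      induction n, hn using Nat.le_induction with
      | base => exact fun _ => rfl
      | succ n hn ih =>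
        intro hle
        refine ((hnM n ?_).2.1).trans (ih (by omega))
        rw [← hrange]
        rintro ⟨j, rfl⟩
        have h1 := hm.lt_iff_lt.1 (show m k < m j by omega)
        have h2 := hm.lt_iff_lt.1 (show m j < m (k + 1) by omega)
        omega
    obtain ⟨b, hb, hpref⟩ := r.exists_branch (x := fun k => (x (m k + 1)).1.1)
      (fun k => (x _).2.1) fun k => by
        obtain ⟨i, hi, _⟩ := hmM (k + 1)
        exact ⟨i, by rw [hi, hconst k _ (hm (Nat.lt_succ_self k)) le_rfl]⟩
    -- The first node reached may lie deep in the run-tree, so the play is compared with a tail of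
    -- the branch.
    have := (A.win_shift (x (m 0 + 1)).1.1.length).2
      ((A.parityWin_iff (s := fun n => (r.label (LTree.pref b n)).2)).1 (hw b hb))
    simp only [hpref] at this
    obtain ⟨d, hd, hl⟩ := this
    refine ⟨d, hd, LimCol.of_subseq hm (fun n hn => (hnM n (hrange ▸ hn)).1) ?_⟩
    convert hl using 2 with k
    obtain ⟨i, _, hi⟩ := hmM k
    exact hi
  · exact congrArg Prod.snd hr.root

end APT

/-! ### Possibly empty paths -/

section Reach

variable {C X : Type} [LinearOrder C] [OrderBot C]

/-- There is a possibly empty path from `x` to `y`, the greatest colour of which is `c`. -/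
def Reach (E : X → C → X → Prop) (x : X) (c : C) (y : X) : Prop :=
  (x = y ∧ c = ⊥) ∨ Path E x c y

variable {E : X → C → X → Prop}

theorem Reach.refl (x : X) : Reach E x ⊥ x := .inl ⟨rfl, rfl⟩

theorem Reach.trans {x c y d z} (h : Reach E x c y) (k : Reach E y d z) :
    Reach E x (max c d) z := by
  rcases h with ⟨rfl, rfl⟩ | h
  · rwa [max_eq_right bot_le]
  · rcases k with ⟨rfl, rfl⟩ | k
    · rw [max_eq_left bot_le]
      exact .inr h
    · exact .inr (h.trans k)

theorem Reach.cons {x c y d z} (h : E x c y) (k : Reach E y d z) : Path E x (max c d) z := by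
  rcases k with ⟨rfl, rfl⟩ | k
  · rw [max_eq_left bot_le]
    exact .single h
  · exact .cons h k

end Reach

namespace APT

open FinScottL

variable {S : Sig} (A : APT S)

/-! ### The interpretation of terms, in elementary terms -/

/-- The part of a context that is available below the colour `c`. -/
noncomputable def shift {X : FinScottL} (u : Finset (A.Col × X)) (c : A.Col) :
    Finset (A.Col × X) :=
  (Set.toFinite {z : A.Col × X | (max c z.1, z.2) ∈ u}).toFinset

theorem mem_shift {X : FinScottL} {u : Finset (A.Col × X)} {c : A.Col} {z : A.Col × X} :
    z ∈ A.shift u c ↔ (max c z.1, z.2) ∈ u := by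
  simp [shift]

theorem bang_le_of_subset {X : FinScottL} {u v : Finset (A.Col × X)} (h : u ⊆ v) :
    (show A.Bang X from u) ≤ v :=
  fun z hz => ⟨z, h hz, rfl, le_rfl⟩

/-- The comultiplication splits a colour as `max c₁ c₂`: a copy used below colour `c` may use an
element at colour `d` exactly when the context offers it at `max c d`, whence `shift`. Downward
closure lets `shift u p.1` serve as the largest choice. -/
theorem promote_rel {X Y : FinScottL} {T : A.KHom X Y} {u : Finset (A.Col × X)}
    {v : Finset (A.Col × Y)} :
    (A.promote T).rel u v ↔ ∀ p ∈ v, T.rel (A.shift u p.1) p.2 := by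
  constructor
  · rintro ⟨U, hU, h⟩ p hp
    obtain ⟨x, hx, hxp, hT⟩ := h p hp
    refine T.down hT (fun z hz => ?_) le_rfl
    obtain ⟨a, ha, hza⟩ := (cbDig_rel A.Col).1 hU x hx z hz
    refine ⟨(z.1, a), A.mem_shift.2 ?_, rfl, hza⟩
    rw [← (show x.1 = p.1 from hxp)]
    exact ha
  · intro h
    obtain ⟨U, hU⟩ := exists_finset fun y : A.Col × Finset (A.Col × X) =>
      ∀ z ∈ y.2, ∃ a', (max y.1 z.1, a') ∈ u ∧ z.2 ≤ a'
    refine ⟨U, (cbDig_rel A.Col).2 fun y hy => (hU y).1 hy, fun p hp => ?_⟩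
    exact ⟨(p.1, A.shift u p.1), (hU _).2 fun z hz => ⟨z.2, A.mem_shift.1 hz, le_rfl⟩, rfl, h p hp⟩

theorem apply_rel {X Y Z : FinScottL} {R : A.KHom X (lolli (Bang A Y) Z)} {T : A.KHom X Y}
    {u : Finset (A.Col × X)} {z : Z} :
    (A.apply R T).rel u z ↔ ∃ v : Finset (A.Col × Y), R.rel u (v, z) ∧
      ∀ p ∈ v, T.rel (A.shift u p.1) p.2 :=
  exists_congr fun _ => and_congr_right fun _ => A.promote_rel

theorem der_comp_rel {X Y : FinScottL} {R : X ⟶ Y} {u : Finset (A.Col × X)} {y : Y} :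
    ((cb A.Col).ε.app X ≫ R).rel u y ↔ ∃ x, (⊥, x) ∈ u ∧ R.rel x y := by
  constructor
  · rintro ⟨x, hx, hR⟩
    obtain ⟨x', hx', hle⟩ := (cbDer_rel A.Col).1 hx
    exact ⟨x', hx', R.down hR hle le_rfl⟩
  · rintro ⟨x, hx, hR⟩
    exact ⟨x, (cbDer_rel A.Col).2 ⟨x, hx, le_rfl⟩, hR⟩

/-! ### Semantic run-trees as coloured graphs -/

variable (G : HORS S)

/-- A winning strategy in the fixpoint game: every vertex carries an element of the interpretation
of a non-terminal, which the right-hand side derives from the labels of the successors. -/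
structure IsSemEval {W : Type} (lab : W → A.denNT G.ty) (E : W → A.Col → W → Prop) : Prop where
  step : ∀ w, ∃ v : Finset (A.Col × A.denNT G.ty), (∀ p ∈ v, ∃ w', E w p.1 w' ∧ lab w' = p.2) ∧
    (A.denRule G.ty (G.rule (lab w).1)).rel v (lab w).2
  win : A.InfWin E

variable {A G}

/-- The nodes of the run-tree become vertices, and an edge takes the colour of its target. No node
has a label in `top`, which is empty. -/
theorem exists_isSemEval_of_fixRel {a : A.denNT G.ty} (h : A.fixRel (A.ruleHom G) ∅ a) :
    ∃ (W : Type) (lab : W → A.denNT G.ty) (E : W → A.Col → W → Prop) (w₀ : W),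
      A.IsSemEval G lab E ∧ lab w₀ = a := by
  obtain ⟨t, ht, -, hw⟩ := h
  have hlab : ∀ p : t.nodes, ∃ b, (t.label p.1).1 = Sum.inr b := by
    rintro ⟨p, hp⟩
    cases h : (t.label p).1 with
    | inl x => exact (show Empty from x).elim
    | inr b => exact ⟨b, rfl⟩
  choose lab hlab using hlab
  refine ⟨t.nodes, lab, fun p c p' => (∃ i, p'.1 = p.1 ++ [i]) ∧ (t.label p'.1).2 = c,
    ⟨[], t.root_mem⟩, ⟨fun p => ?_, fun x c hx => ?_⟩, ?_⟩
  · obtain ⟨u, v, -, hv, hR⟩ := ht.step p.1 p.2 _ (hlab p)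
    refine ⟨v, ?_, hR⟩
    rintro ⟨c, y⟩ hy
    obtain ⟨i, hi, hl⟩ := (hv c y).1 hy
    refine ⟨⟨_, hi⟩, ⟨⟨i, rfl⟩, by rw [hl]⟩, ?_⟩
    have := hlab ⟨_, hi⟩
    rw [hl] at this
    exact (Sum.inr.inj this).symm
  · obtain ⟨b, hb, hpref⟩ := t.exists_branch (fun n => (x n).2) fun n => (hx n).1
    have := (A.win_shift (x 0).1.length).2 (A.colWin_iff.1 (hw b hb))
    simp only [hpref] at this
    -- The `n`-th edge bears the colour of node `n + 1`.
    have := (A.win_shift 1).2 this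
    simpa only [(hx _).2] using this
  · have := hlab ⟨[], t.root_mem⟩
    rw [ht.root] at this
    exact (Sum.inr.inj this).symm

/-- Colours sit on the edges of a graph but on the nodes of a run-tree, so a node of the unfolding
remembers the colour of the edge by which it was entered; the root gets `⊥`. -/
theorem IsSemEval.fixRel {W : Type} {lab : W → A.denNT G.ty} {E : W → A.Col → W → Prop}
    (h : A.IsSemEval G lab E) (w₀ : W) : A.fixRel (A.ruleHom G) ∅ (lab w₀) := by
  choose v hv hrel using h.step
  choose next hE hlab using hv
  let ch : W × A.Col → List (W × A.Col) := fun x =>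
    (v x.1).toList.attach.map fun p => (next x.1 p.1 (Finset.mem_toList.1 p.2), p.1.1)
  have hmem : ∀ x y, y ∈ ch x ↔ ∃ p, ∃ hp : p ∈ v x.1, y = (next x.1 p hp, p.1) := by
    intro x y
    simp only [ch, List.mem_map, List.mem_attach, true_and]
    constructor
    · rintro ⟨p, rfl⟩
      exact ⟨p.1, Finset.mem_toList.1 p.2, rfl⟩
    · rintro ⟨p, hp, rfl⟩
      exact ⟨⟨p, Finset.mem_toList.2 hp⟩, rfl⟩
  let labT : W × A.Col → (top ⊕ A.denNT G.ty) × A.Col := fun x => (Sum.inr (lab x.1), x.2)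
  refine ⟨LTree.unfold ch labT (w₀, ⊥), ⟨rfl, fun _ _ x => (show Empty from x).elim, ?_⟩,
    fun _ x => (show Empty from x).elim, ?_⟩
  · intro p hp b hb
    obtain ⟨x, _, hl, hc⟩ := LTree.unfold_node hp
    rw [hl] at hb
    obtain rfl := Sum.inr.inj hb
    refine ⟨∅, v x.1, fun _ x => (show Empty from x).elim, fun c y => ?_, hrel x.1⟩
    rw [hc]
    constructor
    · intro hy
      exact ⟨_, (hmem _ _).2 ⟨_, hy, rfl⟩, by simp only [labT, hlab]⟩
    · rintro ⟨z, hz, hl⟩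
      obtain ⟨p, hp, rfl⟩ := (hmem _ _).1 hz
      simp only [labT, hlab, Prod.mk.injEq, Sum.inr.injEq] at hl
      obtain ⟨rfl, rfl⟩ := hl
      exact hp
  · intro b hb
    obtain ⟨x, _, hx, hl⟩ := LTree.unfold_branch hb
    rw [A.colWin_iff, ← A.win_shift 1]
    simp only [hl]
    refine h.win (fun n => (x n).1) _ fun n => ?_
    obtain ⟨p, hp, he⟩ := (hmem _ _).1 (hx n)
    simp only [labT]
    rw [he]
    exact hE _ _ _

/-! ### From head reductions to the model -/

section Completeness

variable (A) {N : Type} {ty : N → Ty} {X : Type} (term : X → Term S ty [] .o)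
  (st : X → A.Q) (E : X → A.Col → X → Prop)

/-- The element of `A.den σ` that describes how the head of the term at the vertex `x`, to which the
arguments `as` are applied, uses its arguments below `x`. -/
noncomputable def tyAt : ∀ σ : Ty, X → Args S ty σ → A.den σ
  | .o, x, _ => st x
  | .arr σ τ, x, as =>
    ((Set.toFinite {p : A.Col × A.den σ | ∃ y bs, Reach E x p.1 y ∧
      term y = Args.apply as.head bs ∧ p.2 = tyAt σ y bs}).toFinset, tyAt τ x as.tail)

theorem mem_tyAt {σ τ : Ty} {x : X} {as : Args S ty (.arr σ τ)} {p : A.Col × A.den σ} :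
    p ∈ (show Finset (A.Col × A.den σ) from (A.tyAt term st E _ x as).1) ↔
      ∃ y bs, Reach E x p.1 y ∧ term y = Args.apply as.head bs ∧
        p.2 = A.tyAt term st E σ y bs := by
  simp [tyAt]

/-- The arguments of a symbol have ground type, so such an argument is at the head of a vertex when
it is the whole term there, and its description is the state. -/
theorem spine_tyAt : ∀ (n : ℕ) {x : X} (as : Args S ty (Ty.first n)),
    (A.spine n (A.tyAt term st E _ x as)).2 = st x ∧
      ∀ k c y, Reach E x c y → term y = as.get k →
        (c, st y) ∈ (A.spine n (A.tyAt term st E _ x as)).1 k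
  | 0, _, _ => ⟨rfl, fun k => k.elim0⟩
  | n + 1, x, as => by
    obtain ⟨h1, h2⟩ := spine_tyAt n (x := x) as.tail
    refine ⟨h1, fun k c y hr hy => ?_⟩
    induction k using Fin.cases with
    | zero => exact (A.mem_tyAt term st E).2 ⟨y, .nil, hr, hy, rfl⟩
    | succ k => exact h2 k c y hr hy

variable [Finite N]

/-- The vertex `y` is headed by the variable or non-terminal which the element of the context
belongs to, and that element describes this occurrence. -/
def HeadElt (y : X) : ∀ (Γ : List Ty), Env S ty Γ → A.denCtx ty Γ → Prop
  | [], _, e => ∃ bs, term y = Args.apply (.nt e.1) bs ∧ e.2 = A.tyAt term st E _ y bs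
  | σ :: _, ρ, .inl b => ∃ bs, term y = Args.apply (ρ σ .zero) bs ∧ b = A.tyAt term st E _ y bs
  | _ :: Γ, ρ, .inr e => HeadElt y Γ (fun _ x => ρ _ x.succ) e

/-- The elements of the context that are used below `x`. -/
noncomputable def ctxAt {Γ : List Ty} (x : X) (ρ : Env S ty Γ) :
    Finset (A.Col × A.denCtx ty Γ) :=
  (Set.toFinite {p : A.Col × A.denCtx ty Γ | ∃ y, Reach E x p.1 y ∧
    A.HeadElt term st E y Γ ρ p.2}).toFinset

theorem mem_ctxAt {Γ : List Ty} {x : X} {ρ : Env S ty Γ} {p : A.Col × A.denCtx ty Γ} :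
    p ∈ A.ctxAt term st E x ρ ↔ ∃ y, Reach E x p.1 y ∧ A.HeadElt term st E y Γ ρ p.2 := by
  simp [ctxAt]

theorem exists_headElt_var {Γ : List Ty} {σ : Ty} (z : Var Γ σ) (ρ : Env S ty Γ) {x : X}
    {as : Args S ty σ} (h : term x = as.apply (ρ _ z)) :
    ∃ e, A.HeadElt term st E x Γ ρ e ∧ (A.projVar ty z).rel e (A.tyAt term st E σ x as) := by
  induction z with
  | zero => exact ⟨Sum.inl _, ⟨as, h, rfl⟩, _, rfl, le_rfl⟩
  | succ z ih =>
    obtain ⟨e, he, hR⟩ := ih (fun _ x => ρ _ x.succ) h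
    exact ⟨Sum.inr e, he, e, ⟨e, rfl, le_rfl⟩, hR⟩

theorem exists_headElt_nt {F : N} {x : X} {as : Args S ty (ty F)} (h : term x = as.apply (.nt F)) :
    ∀ {Γ : List Ty} (ρ : Env S ty Γ), ∃ e, A.HeadElt term st E x Γ ρ e ∧
      (A.projNT ty F Γ).rel e (A.tyAt term st E _ x as)
  | [], _ => ⟨⟨F, A.tyAt term st E _ x as⟩, ⟨as, h, rfl⟩, _, rfl, le_rfl⟩
  | σ :: Γ, ρ => by
    obtain ⟨e, he, hR⟩ := exists_headElt_nt h (Γ := Γ) fun _ x => ρ _ x.succ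
    exact ⟨Sum.inr e, he, e, ⟨e, rfl, le_rfl⟩, hR⟩

end Completeness

section Completeness

variable {X : Type} {term : X → Term S G.ty [] .o} {st : X → A.Q} {E : X → A.Col → X → Prop}

/-- The sets in `tyAt` and `ctxAt` are closed under everything the strategy does below `x`: uses are
recognised by equality of terms, so no occurrence has to be traced back to its origin. The arguments
`as` are arbitrary, which lets the induction on `M` pass through applications. -/
theorem IsEval.denTerm_rel (h : A.IsEval G term st E) {Γ : List Ty} {σ : Ty}
    (M : Term S G.ty Γ σ) (ρ : Env S G.ty Γ) {x : X} {as : Args S G.ty σ}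
    (hx : term x = as.apply (M.subst ρ)) :
    (A.denTerm G.ty M).rel (A.ctxAt term st E x ρ) (A.tyAt term st E σ x as) := by
  induction M generalizing x with
  | const a =>
    obtain ⟨φ, hφ, hs⟩ := h.sym x a as hx
    obtain ⟨h1, h2⟩ := A.spine_tyAt term st E _ (x := x) as
    refine ⟨φ, h1 ▸ hφ, fun k q hk => ?_⟩
    obtain ⟨y, hE, ht, rfl⟩ := hs k q hk
    exact h2 k _ y (.inr (.single hE)) ht
  | nt F =>
    obtain ⟨e, he, hR⟩ := A.exists_headElt_nt term st E hx ρ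
    exact A.der_comp_rel.2 ⟨e, (A.mem_ctxAt term st E).2 ⟨x, .refl x, he⟩, hR⟩
  | var z =>
    obtain ⟨e, he, hR⟩ := A.exists_headElt_var term st E z ρ hx
    exact A.der_comp_rel.2 ⟨e, (A.mem_ctxAt term st E).2 ⟨x, .refl x, he⟩, hR⟩
  | app M P ihM ihP =>
    refine A.apply_rel.2 ⟨_, ihM (as := .cons (P.subst ρ) as) hx, fun p hp => ?_⟩
    obtain ⟨y, bs, hr, hy, hp2⟩ := (A.mem_tyAt term st E).1 hp
    rw [hp2]
    -- What is used below `y` at colour `d` is used below `x` at the maximum of `d` and the colour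
    -- from `x` to `y`, which is what `shift` asks for.
    refine (A.denTerm G.ty P).down (ihP hy) (A.bang_le_of_subset fun z hz => ?_) le_rfl
    obtain ⟨y', hr', hy'⟩ := (A.mem_ctxAt term st E).1 hz
    exact A.mem_shift.2 ((A.mem_ctxAt term st E).2 ⟨y', hr.trans hr', hy'⟩)

/-- Here `x'` follows `x` by the unfolding of a non-terminal. That path is neutral, so all uses of
the arguments below `x'` are already recorded at `x` with the same colours, and abstraction may
discharge them. -/
theorem IsEval.denRule_rel (h : A.IsEval G term st E) {Γ : List Ty} {σ : Ty}
    (r : Rule S G.ty Γ σ) (ρ : Env S G.ty Γ) {x x' : X} {as : Args S G.ty σ}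
    (hx : term x' = r.inst ρ as) (hr : Reach E x ⊥ x') (hst : st x' = st x) :
    (A.denRule G.ty r).rel (A.ctxAt term st E x' ρ) (A.tyAt term st E σ x as) := by
  induction r with
  | body t =>
    cases as
    have := h.denTerm_rel t ρ (x := x') (as := .nil) hx
    rwa [show A.tyAt term st E .o x .nil = A.tyAt term st E .o x' .nil from hst.symm]
  | lam r ih =>
    cases as with
    | cons P as =>
      refine (A.denRule G.ty r).down (ih (Env.cons P ρ) hx) (A.bang_le_of_subset ?_) le_rfl
      rintro ⟨c, b | e⟩ hz
      · obtain ⟨y, hr', bs, hy, hb⟩ := (A.mem_ctxAt term st E).1 hz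
        refine A.mem_seely_inl.2 ((A.mem_tyAt term st E).2 ⟨y, bs, ?_, hy, hb⟩)
        have := hr.trans hr'
        rwa [max_eq_right bot_le] at this
      · obtain ⟨y, hr', hy⟩ := (A.mem_ctxAt term st E).1 hz
        exact A.mem_seely_inr.2 ((A.mem_ctxAt term st E).2 ⟨y, hr', hy⟩)

/-- Between two vertices headed by non-terminals, the strategy follows a path. It is non-empty
because it starts with the unfolding move, whose colour `⊥` leaves the maximum unchanged. -/
theorem IsEval.exists_isSemEval (h : A.IsEval G term st E) {x₀ : X} {F₀ : G.N}
    {as₀ : Args S G.ty (G.ty F₀)} (h₀ : term x₀ = as₀.apply (.nt F₀)) :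
    ∃ (W : Type) (lab : W → A.denNT G.ty) (E' : W → A.Col → W → Prop) (w₀ : W),
      A.IsSemEval G lab E' ∧ lab w₀ = ⟨F₀, A.tyAt term st E _ x₀ as₀⟩ := by
  refine ⟨{w : X × Σ F, Args S G.ty (G.ty F) // term w.1 = w.2.2.apply (.nt w.2.1)},
    fun w => ⟨w.1.2.1, A.tyAt term st E _ w.1.1 w.1.2.2⟩, fun w c w' => Path E w.1.1 c w'.1.1,
    ⟨(x₀, ⟨F₀, as₀⟩), h₀⟩, ⟨?_, fun w c hw => h.win.path (fun n => (w n).1.1) c hw⟩, rfl⟩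
  rintro ⟨⟨x, F, as⟩, hx⟩
  obtain ⟨x', hE, hx', hst⟩ := h.red x F as hx
  refine ⟨_, ?_, h.denRule_rel (G.rule F) Env.nil hx' (.inr (.single hE)) hst⟩
  rintro ⟨c, ⟨F', a⟩⟩ hp
  obtain ⟨y, hr, bs, hy, ha⟩ := (A.mem_ctxAt term st E).1 hp
  refine ⟨⟨(y, ⟨F', bs⟩), hy⟩, ?_, ?_⟩
  · have := hr.cons hE
    rwa [max_eq_right bot_le] at this
  · exact congrArg (Sigma.mk F') ha.symm

end Completeness

/-- The arguments of the start symbol. -/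
theorem startTerm_eq : ∃ as : Args S G.ty (G.ty G.start), G.startTerm = as.apply (.nt G.start) ∧
    ∀ {X : Type} (term : X → Term S G.ty [] .o) (st : X → A.Q) (E : X → A.Col → X → Prop) (x : X),
      A.tyAt term st E _ x as = A.startElt G (st x) := by
  -- Generalising the type of the start symbol makes the cast along `G.start_ty` disappear.
  have : ∀ (σ : Ty) (h : σ = .o) (M : Term S G.ty [] σ), ∃ as : Args S G.ty σ,
      h ▸ M = as.apply M ∧ ∀ {X : Type} (term : X → Term S G.ty [] .o) (st : X → A.Q)
        (E : X → A.Col → X → Prop) (x : X),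
        A.tyAt term st E σ x as = h.symm ▸ (show A.den .o from st x) := by
    rintro _ rfl M
    exact ⟨.nil, rfl, fun _ _ _ _ => rfl⟩
  exact this _ G.start_ty (.nt G.start)

theorem mem_interp_of_accepts {q₀ : A.Q} (h : A.Accepts G.valueTree q₀) : q₀ ∈ A.interp G := by
  obtain ⟨X, term, st, E, x₀, hE, h₀, rfl⟩ := exists_isEval_of_accepts h
  obtain ⟨as, h1, h2⟩ := startTerm_eq (A := A) (G := G)
  obtain ⟨W, lab, E', w₀, hW, hw⟩ := hE.exists_isSemEval (h₀.trans h1)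
  have := hW.fixRel w₀
  rwa [hw, h2] at this

end APT

namespace APT

open FinScottL

variable {S : Sig} (A : APT S) (G : HORS S) {W : Type} (lab : W → A.denNT G.ty)

/-! ### From the model to head reductions -/

/-- The element `v → x` of the interpretation of a function type. -/
def arrow {σ τ : Ty} (v : Finset (A.Col × A.den σ)) (x : A.den τ) : A.den (.arr σ τ) := (v, x)

/-- Derivations of an element of the interpretation for a closed term; non-terminals are justified
by vertices of a graph that are labelled in the interpretation of the non-terminals. -/
inductive Der : ∀ {σ : Ty}, Term S G.ty [] σ → A.den σ → Type
  | const (a : S.sym) (x : A.den (Ty.first (S.ar a)))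
      (h : A.Sat (A.spine _ x).2 a (A.spine _ x).1) : Der (.const a) x
  | nt (F : G.N) (x : A.den (G.ty F)) (w : W) (h : lab w = ⟨F, x⟩) : Der (.nt F) x
  | app {σ τ : Ty} {M : Term S G.ty [] (.arr σ τ)} {P : Term S G.ty [] σ}
      (v : Finset (A.Col × A.den σ)) (x : A.den τ)
      (D : Der M (A.arrow v x)) (B : ∀ p ∈ v, Der P p.2) : Der (.app M P) x
  | sub {σ : Ty} {M : Term S G.ty [] σ} (x y : A.den σ) (D : Der M y) (h : x ≤ y) : Der M x

/-- Derivations for the arguments that an element of the interpretation asks for. -/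
def Stk : ∀ {σ : Ty}, Args S G.ty σ → A.den σ → Type
  | _, .nil, _ => Unit
  | .arr σ _, .cons P as, x =>
    (∀ p ∈ (show Finset (A.Col × A.den σ) from x.1), A.Der G lab P p.2) × Stk as x.2

/-- The state at the end of an element of the interpretation of a type. -/
def res : ∀ {σ : Ty}, A.den σ → A.Q
  | .o, q => q
  | .arr _ _, x => res x.2

theorem res_le : ∀ {σ : Ty} {x y : A.den σ}, x ≤ y → A.res x = A.res y
  | .o, _, _, h => h
  | .arr _ τ, _, _, h => res_le (σ := τ) h.2

variable {A G lab}

/-- Derivations for one more argument. -/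
def Stk.push {σ τ : Ty} {P : Term S G.ty [] σ} {as : Args S G.ty τ}
    {v : Finset (A.Col × A.den σ)} {x : A.den τ} (B : ∀ p ∈ v, A.Der G lab P p.2)
    (π : A.Stk G lab as x) : A.Stk G lab (.cons P as) (A.arrow v x) := (B, π)

/-- Arguments for a smaller element provide arguments for a greater one. -/
noncomputable def Stk.raise : ∀ {σ : Ty} {as : Args S G.ty σ} {x y : A.den σ}, x ≤ y →
    A.Stk G lab as x → A.Stk G lab as y
  | _, .nil, _, _, _, _ => ()
  | .arr _ _, .cons _ _, _, _, h, π =>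
    (fun p hp => .sub _ _ (π.1 _ (h.1 p hp).choose_spec.1) (h.1 p hp).choose_spec.2.2,
      Stk.raise h.2 π.2)

/-- The arguments of a symbol. -/
noncomputable def Stk.get : ∀ {n : ℕ} {as : Args S G.ty (Ty.first n)} {x : A.den (Ty.first n)},
    A.Stk G lab as x → ∀ (k : Fin n) (p : A.Col × A.Q), p ∈ (A.spine n x).1 k →
      A.Der G lab (as.get k) (show A.den .o from p.2)
  | 0, _, _, _, k, _, _ => k.elim0
  | _ + 1, .cons _ _, _, π, ⟨0, _⟩, p, hp => π.1 p hp
  | _ + 1, .cons _ _, _, π, ⟨k + 1, hk⟩, p, hp => Stk.get π.2 ⟨k, Nat.lt_of_succ_lt_succ hk⟩ p hp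

variable (A G lab) in
/-- Justifications for an element of a context: a derivation for the term that is substituted for a
variable, or a vertex for a non-terminal. -/
def EnvDer : ∀ {Γ : List Ty}, Env S G.ty Γ → A.denCtx G.ty Γ → Type
  | [], _, e => {w : W // lab w = e}
  | σ :: _, ρ, .inl b => A.Der G lab (ρ σ .zero) b
  | _ :: _, ρ, .inr e => EnvDer (fun _ x => ρ _ x.succ) e

/-- The derivation for a variable. -/
noncomputable def EnvDer.var : ∀ {Γ : List Ty} {σ : Ty} (z : Var Γ σ) {ρ : Env S G.ty Γ}
    {e : A.denCtx G.ty Γ} {x : A.den σ}, (A.projVar G.ty z).rel e x → A.EnvDer G lab ρ e →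
    A.Der G lab (ρ _ z) x
  | _, _, .zero, _, .inl b, x, h, D =>
    .sub x b D (by obtain ⟨b', hb, hx⟩ := h; cases hb; exact hx)
  | _, _, .zero, _, .inr e, _, h, _ => False.elim (by obtain ⟨b', hb, hx⟩ := h; cases hb)
  | _, _, .succ _, _, .inl b, _, h, _ => False.elim (by obtain ⟨e, ⟨b', hb, _⟩, _⟩ := h; cases hb)
  | _, _, .succ z, _, .inr e, _, h, D =>
    EnvDer.var z (by
      obtain ⟨e, ⟨e', he, hle⟩, h⟩ := h
      cases he
      exact (A.projVar G.ty z).down h hle le_rfl) D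

/-- The derivation for a non-terminal. -/
noncomputable def EnvDer.nt (F : G.N) : ∀ {Γ : List Ty} {ρ : Env S G.ty Γ}
    {e : A.denCtx G.ty Γ} {x : A.den (G.ty F)}, (A.projNT G.ty F Γ).rel e x → A.EnvDer G lab ρ e →
    A.Der G lab (.nt F) x
  | [], _, _, x, h, D =>
    .sub x h.choose (.nt F h.choose D.1 (D.2.trans h.choose_spec.1)) h.choose_spec.2
  | _ :: _, _, .inl b, _, h, _ => False.elim (by obtain ⟨e, ⟨b', hb, _⟩, _⟩ := h; cases hb)
  | _ :: Γ, _, .inr e, _, h, D =>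
    EnvDer.nt F (Γ := Γ) (by
      obtain ⟨e, ⟨e', he, hle⟩, h⟩ := h
      cases he
      exact (A.projNT G.ty F Γ).down h hle le_rfl) D

/-- The derivation for a closed instance of a term. -/
noncomputable def build : ∀ {Γ : List Ty} {σ : Ty} (M : Term S G.ty Γ σ) {ρ : Env S G.ty Γ}
    {u : Finset (A.Col × A.denCtx G.ty Γ)} {x : A.den σ}, (A.denTerm G.ty M).rel u x →
    (∀ p ∈ u, A.EnvDer G lab ρ p.2) → A.Der G lab (M.subst ρ) x
  | _, _, .const a, _, _, x, h, _ => .const a x h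
  | _, _, .nt F, _, _, _, h, env =>
    EnvDer.nt F (A.der_comp_rel.1 h).choose_spec.2 (env _ (A.der_comp_rel.1 h).choose_spec.1)
  | _, _, .var z, _, _, _, h, env =>
    EnvDer.var z (A.der_comp_rel.1 h).choose_spec.2 (env _ (A.der_comp_rel.1 h).choose_spec.1)
  | _, _, .app M P, _, _, x, h, env =>
    .app (A.apply_rel.1 h).choose x (build M (A.apply_rel.1 h).choose_spec.1 env) fun p hp =>
      build P ((A.apply_rel.1 h).choose_spec.2 p hp) fun z hz =>
        env (max p.1 z.1, z.2) (A.mem_shift.1 hz)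

/-- Extension of a justified context by the derivations for an argument. -/
noncomputable def consEnv {Γ : List Ty} {σ : Ty} {P : Term S G.ty [] σ} {ρ : Env S G.ty Γ}
    {v : Finset (A.Col × A.den σ)} {u : Finset (A.Col × A.denCtx G.ty Γ)}
    (B : ∀ p ∈ v, A.Der G lab P p.2) (env : ∀ p ∈ u, A.EnvDer G lab ρ p.2) :
    ∀ p ∈ (show Finset (A.Col × A.denCtx G.ty (σ :: Γ)) from A.seely v u),
      A.EnvDer G lab (Env.cons P ρ) p.2
  | (_, .inl _), hp => B _ (A.mem_seely_inl.1 hp)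
  | (_, .inr _), hp => env _ (A.mem_seely_inr.1 hp)

/-- The derivation for the instance of a right-hand side at given arguments. -/
noncomputable def buildRule : ∀ {Γ : List Ty} {σ : Ty} (r : Rule S G.ty Γ σ) {ρ : Env S G.ty Γ}
    {u : Finset (A.Col × A.denCtx G.ty Γ)} {x : A.den σ}, (A.denRule G.ty r).rel u x →
    (∀ p ∈ u, A.EnvDer G lab ρ p.2) → ∀ {as : Args S G.ty σ}, A.Stk G lab as x →
    A.Der G lab (r.inst ρ as) (show A.den .o from A.res x)
  | _, _, .body t, _, _, _, h, env, .nil, _ => build t h env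
  | _, _, .lam r, _, _, _, h, env, .cons _ _, π => buildRule r h (consEnv π.1 env) π.2

variable (A G lab) in
/-- A derivation for a closed term together with derivations for its arguments. -/
structure Conf where
  {σ : Ty}
  {M : Term S G.ty [] σ}
  {x : A.den σ}
  D : A.Der G lab M x
  {as : Args S G.ty σ}
  π : A.Stk G lab as x

/-- The term that is derived by a configuration. -/
def Conf.term (s : A.Conf G lab) : Term S G.ty [] .o := s.as.apply s.M

/-- The state that is derived by a configuration. -/
def Conf.st (s : A.Conf G lab) : A.Q := A.res s.x

/-- The configuration of a derivation for a term of ground type. -/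
def Conf.ground {t : Term S G.ty [] .o} {q : A.den .o} (D : A.Der G lab t q) : A.Conf G lab :=
  ⟨D, (show A.Stk G lab .nil q from ())⟩

theorem spine_snd : ∀ (n : ℕ) (x : A.den (Ty.first n)), (A.spine n x).2 = A.res x
  | 0, _ => rfl
  | n + 1, x => spine_snd n x.2

variable (A G) in
/-- The elements of a context from which the right-hand side of the rule at a vertex derives its
label, and the vertices which justify them. -/
structure Justified (W : Type) (lab : W → A.denNT G.ty) where
  v : W → Finset (A.Col × A.denNT G.ty)
  next : ∀ w, ∀ p ∈ v w, W
  lab_next : ∀ w p hp, lab (next w p hp) = p.2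
  rel : ∀ w F x, lab w = ⟨F, x⟩ → (A.denRule G.ty (G.rule F)).rel (v w) x

/-- The derivation that arises by unfolding a non-terminal. -/
noncomputable def Justified.unfold (J : A.Justified G W lab) {F : G.N} {x : A.den (G.ty F)} {w : W}
    (h : lab w = ⟨F, x⟩) {as : Args S G.ty (G.ty F)} (π : A.Stk G lab as x) :
    A.Der G lab ((G.rule F).inst Env.nil as) (show A.den .o from A.res x) :=
  buildRule (G.rule F) (ρ := Env.nil) (J.rel w F x h)
    (fun p hp => (⟨J.next w p hp, J.lab_next w p hp⟩ : {w' : W // lab w' = p.2})) π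

/-- The moves from the configuration of a derivation and its arguments. -/
def MoveFrom (J : A.Justified G W lab) : ∀ {σ : Ty} {M : Term S G.ty [] σ} {x : A.den σ},
    A.Der G lab M x → ∀ {as : Args S G.ty σ}, A.Stk G lab as x → A.Col → A.Conf G lab → Prop
  | _, _, _, .app _ _ D B, _, π, c, s' => c = ⊥ ∧ s' = ⟨D, Stk.push B π⟩
  | _, _, _, .sub _ _ D h, _, π, c, s' => c = ⊥ ∧ s' = ⟨D, π.raise h⟩
  | _, _, _, .nt _ _ _ h, _, π, c, s' => c = ⊥ ∧ s' = .ground (J.unfold h π)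
  | _, _, _, .const _ _ h, _, π, c, s' => ∃ (k : _) (q : A.Q) (hk : (k, q) ∈ h.choose),
    c = A.col q ∧ s' = .ground (π.get k (A.col q, q) (h.choose_spec.2 k q hk))

/-- The moves between configurations: the machine looks for the head of the term, unfolds
non-terminals, and proceeds to an argument of a symbol. -/
def Move (J : A.Justified G W lab) (s : A.Conf G lab) : A.Col → A.Conf G lab → Prop :=
  MoveFrom J s.D s.π

/-- Every configuration allows the moves which the acceptance game asks for. -/
theorem Move.step (J : A.Justified G W lab) (s : A.Conf G lab) :
    (∃ s', Move J s ⊥ s' ∧ Relation.ReflTransGen G.Step s.term s'.term ∧ s'.st = s.st) ∨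
    ∃ a as, s.term = Args.apply (.const a) as ∧ ∃ φ ∈ A.δ s.st a, ∀ d q, (d, q) ∈ φ →
      ∃ s', Move J s (A.col q) s' ∧ s'.term = as.get d ∧ s'.st = q := by
  obtain ⟨D, π⟩ := s
  cases D with
  | const a x h =>
    refine .inr ⟨a, _, rfl, h.choose, ?_, fun d q hdq => ?_⟩
    · have key : ∀ q, (A.spine _ x).2 = q → h.choose ∈ A.δ q a := by
        rintro _ rfl
        exact h.choose_spec.1
      exact key _ (spine_snd _ x)
    · exact ⟨_, ⟨d, q, hdq, rfl, rfl⟩, rfl, rfl⟩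
  | nt F x w h => exact .inl ⟨_, ⟨rfl, rfl⟩, .single (.rule F _), rfl⟩
  | app v x D B => exact .inl ⟨_, ⟨rfl, rfl⟩, .refl, rfl⟩
  | sub x y D h => exact .inl ⟨_, ⟨rfl, rfl⟩, .refl, (A.res_le h).symm⟩

/-! #### Losing plays -/

section Good

/-- The levels at which something that is used below the colour `d` has to be good, in order to be
used at level `k`. -/
def AtLevels (c d : A.Col) (k : ℕ) (P : ℕ → Prop) : Prop :=
  ∀ j, d ≤ c → (d = c ∨ j ≤ k) → P j

theorem AtLevels.mono {c d : A.Col} {k k' : ℕ} {P : ℕ → Prop} (h : AtLevels c d k P)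
    (hk : k' ≤ k) : AtLevels c d k' P :=
  fun j hd hj => h j hd (hj.imp_right fun hj => hj.trans hk)

/-- The counterpart of the comultiplication: if `d` or `d'` equals `c`, so does the maximum, and all
levels are allowed; otherwise the bounds on levels compose. -/
theorem AtLevels.max {c d d' : A.Col} {k j : ℕ} {P : ℕ → Prop} (h : AtLevels c (max d d') k P)
    (hd : d ≤ c) (hj : d = c ∨ j ≤ k) : AtLevels c d' j P := by
  intro i hd' hi
  refine h i (max_le hd hd') ?_
  rcases hj with rfl | hj
  · exact .inl (max_eq_left hd')
  · rcases hi with rfl | hi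
    · exact .inl (max_eq_right hd)
    · exact .inr (hi.trans hj)

theorem AtLevels.bot {c : A.Col} {k : ℕ} {P : ℕ → Prop} (h : AtLevels c ⊥ k P) : P k :=
  h k bot_le (.inr le_rfl)

variable (c : A.Col) (T : ℕ → A.Conf G lab → Prop)

/-- Arguments that do not lead to configurations in `T`. -/
def GoodStk : ∀ {σ : Ty} (_ : ℕ) {as : Args S G.ty σ} {x : A.den σ}, A.Stk G lab as x → Prop
  | .o, _, _, _, _ => True
  | .arr σ _, k, .cons _ _, x, π =>
    (∀ p (hp : p ∈ (show Finset (A.Col × A.den σ) from x.1)), AtLevels c p.1 k fun j =>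
      ∀ {as' : Args S G.ty σ} (π' : A.Stk G lab as' p.2), GoodStk j π' → ¬ T j ⟨π.1 p hp, π'⟩) ∧
    GoodStk k π.2

/-- Derivations that do not lead to configurations in `T`, whenever their arguments do not. -/
def Good {σ : Ty} {M : Term S G.ty [] σ} {x : A.den σ} (k : ℕ) (D : A.Der G lab M x) : Prop :=
  ∀ i ≤ k, ∀ {as : Args S G.ty σ} (π : A.Stk G lab as x), GoodStk c T i π → ¬ T i ⟨D, π⟩

variable {c T}

/-- `GoodStk` must inline `Good` in its recursion on types, and does so without the quantifier over
lower levels. That quantifier is absorbed because the levels admitted by `AtLevels` are closed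
downwards. -/
theorem goodStk_cons {σ τ : Ty} {k : ℕ} {P : Term S G.ty [] σ} {as : Args S G.ty τ}
    {x : A.den (.arr σ τ)} {π : A.Stk G lab (.cons P as) x} :
    GoodStk c T k π ↔ (∀ p (hp : p ∈ (show Finset (A.Col × A.den σ) from x.1)),
      AtLevels c p.1 k fun j => Good c T j (π.1 p hp)) ∧ GoodStk c T k π.2 := by
  refine and_congr_left fun _ => forall_congr' fun p => forall_congr' fun hp => ?_
  exact ⟨fun h j hd hj i hi as π' => h i hd (hj.imp_right hi.trans) π',
    fun h j hd hj as π' => h j hd hj j le_rfl π'⟩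

theorem GoodStk.mono {σ : Ty} {as : Args S G.ty σ} {x : A.den σ} {π : A.Stk G lab as x} {k k' : ℕ}
    (h : GoodStk c T k π) (hk : k' ≤ k) : GoodStk c T k' π := by
  induction as with
  | nil => trivial
  | cons P as ih =>
    rw [goodStk_cons] at h ⊢
    exact ⟨fun p hp => (h.1 p hp).mono hk, ih h.2⟩

theorem GoodStk.nil {k : ℕ} {q : A.den .o} {π : A.Stk G lab .nil q} : GoodStk c T k π := trivial

theorem GoodStk.get {n : ℕ} {as : Args S G.ty (Ty.first n)} {x : A.den (Ty.first n)}
    {π : A.Stk G lab as x} {k : ℕ} (h : GoodStk c T k π) (i : Fin n) {p : A.Col × A.Q}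
    (hp : p ∈ (A.spine n x).1 i) : AtLevels c p.1 k fun j => Good c T j (π.get i p hp) := by
  induction n with
  | zero => exact i.elim0
  | succ n ih =>
    cases as with
    | cons P as =>
      obtain ⟨h1, h2⟩ := goodStk_cons.1 h
      obtain ⟨i, hi⟩ := i
      cases i with
      | zero => exact h1 p hp
      | succ i => exact ih h2 ⟨i, _⟩ hp

variable (c T) in
/-- The set `T` contains the tail of a play in which no colour exceeds `c`; the index bounds the
number of moves until the colour `c` occurs. -/
def IsTail (J : A.Justified G W lab) : Prop :=
  ∀ j s, T j s → ∃ d s' j', Move J s d s' ∧ d ≤ c ∧ T j' s' ∧ (d < c → j' < j) ∧ (d = ⊥ → j' ≤ j)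

variable {J : A.Justified G W lab}

theorem good_app (hT : IsTail c T J)
    {σ τ : Ty} {M : Term S G.ty [] (.arr σ τ)} {P : Term S G.ty [] σ}
    {v : Finset (A.Col × A.den σ)} {x : A.den τ}
    {D : A.Der G lab M (A.arrow v x)} {B : ∀ p ∈ v, A.Der G lab P p.2}
    {k : ℕ} (hD : Good c T k D) (hB : ∀ p hp, AtLevels c p.1 k fun j => Good c T j (B p hp)) :
    Good c T k (.app v x D B) := by
  intro i hi as π hπ h
  obtain ⟨d, s', j', ⟨rfl, rfl⟩, -, h', -, hj⟩ := hT _ _ h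
  have hj := hj rfl
  refine hD j' (hj.trans hi) (Stk.push B π) ?_ h'
  exact (goodStk_cons (π := Stk.push B π)).2 ⟨fun p hp => (hB p hp).mono (hj.trans hi), hπ.mono hj⟩

/-- A raised argument is an old one under `sub`, reached after one silent move, which does not raise
the level. The argument's own stack is raised in turn, whence the induction on the type. -/
theorem GoodStk.raise (hT : IsTail c T J)
    {σ : Ty} {as : Args S G.ty σ} {x y : A.den σ} {π : A.Stk G lab as x} {k : ℕ}
    (hπ : GoodStk c T k π) (h : x ≤ y) : GoodStk c T k (π.raise h) := by
  induction σ generalizing k with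
  | o => cases as; trivial
  | arr σ τ ihσ ihτ =>
    cases as with
    | cons P as =>
      obtain ⟨h1, h2⟩ := hπ
      refine ⟨fun p hp j hd hj as' π' hπ' ht => ?_, ihτ h2 h.2⟩
      obtain ⟨hp', hc, hle⟩ := (h.1 p hp).choose_spec
      obtain ⟨d, s', j', ⟨rfl, rfl⟩, -, ht', -, hj'⟩ := hT _ _ ht
      have hj' := hj' rfl
      have hc : p.1 = (h.1 p hp).choose.1 := hc
      refine h1 _ hp' j' (hc ▸ hd) ?_ _ (ihσ (hπ'.mono hj') hle) ht'
      rw [← hc]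
      exact hj.imp_right hj'.trans

theorem good_sub (hT : IsTail c T J)
    {σ : Ty} {M : Term S G.ty [] σ} {x y : A.den σ} {D : A.Der G lab M y} {k : ℕ}
    (hD : Good c T k D) (h : x ≤ y) : Good c T k (.sub x y D h) := by
  intro i hi as π hπ ht
  obtain ⟨d, s', j', ⟨rfl, rfl⟩, -, ht', -, hj⟩ := hT _ _ ht
  have hj := hj rfl
  exact hD j' (hj.trans hi) _ ((hπ.mono hj).raise hT h) ht'

/-- Only here is a non-neutral colour played. It is the colour that annotates the chosen element of
the stack, so either it is `c` and the argument is good at all levels, or the level drops. -/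
theorem good_const (hT : IsTail c T J)
    {a : S.sym} {x : A.den (Ty.first (S.ar a))}
    {h : A.Sat (A.spine _ x).2 a (A.spine _ x).1} {k : ℕ} :
    Good c T k (.const (G := G) (lab := lab) a x h) := by
  intro i hi as π hπ ht
  obtain ⟨d, s', j', ⟨m, q, hm, rfl, rfl⟩, hd, ht', hlt, -⟩ := hT _ _ ht
  refine hπ.get m (p := (A.col q, q)) (h.choose_spec.2 m q hm) j' hd ?_ j' le_rfl _ .nil ht'
  exact hd.eq_or_lt.imp_right fun h => (hlt h).le

variable (c T) in
/-- Justifications of elements of a context that are good. -/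
def GoodEnv (k : ℕ) : ∀ {Γ : List Ty} {ρ : Env S G.ty Γ} {e : A.denCtx G.ty Γ},
    A.EnvDer G lab ρ e → Prop
  | [], _, e, w => Good c T k (.nt e.1 e.2 w.1 w.2)
  | _ :: _, _, .inl _, D => Good c T k D
  | _ :: Γ, _, .inr _, D => GoodEnv k (Γ := Γ) D

theorem GoodEnv.var (hT : IsTail c T J)
    {Γ : List Ty} {σ : Ty} (z : Var Γ σ) {ρ : Env S G.ty Γ} {e : A.denCtx G.ty Γ}
    {x : A.den σ} {h : (A.projVar G.ty z).rel e x} {D : A.EnvDer G lab ρ e} {k : ℕ}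
    (hD : GoodEnv c T k D) : Good c T k (EnvDer.var z h D) := by
  induction z with
  | zero =>
    cases e with
    | inl b => exact good_sub hT hD _
    | inr e => obtain ⟨b', hb, hx⟩ := h; cases hb
  | succ z ih =>
    cases e with
    | inl b => obtain ⟨e, ⟨b', hb, _⟩, _⟩ := h; cases hb
    | inr e => exact ih hD

theorem GoodEnv.nt (hT : IsTail c T J)
    {F : G.N} {Γ : List Ty} {ρ : Env S G.ty Γ} {e : A.denCtx G.ty Γ}
    {x : A.den (G.ty F)} {h : (A.projNT G.ty F Γ).rel e x} {D : A.EnvDer G lab ρ e} {k : ℕ}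
    (hD : GoodEnv c T k D) : Good c T k (EnvDer.nt F h D) := by
  induction Γ with
  | nil =>
    have key : ∀ (e : A.denNT G.ty) (w : W) (hw : lab w = e) (y : A.den (G.ty F))
        (he : e = ⟨F, y⟩), Good c T k (.nt (G := G) e.1 e.2 w hw) →
        Good c T k (.nt F y w (hw.trans he)) := by
      rintro e w hw y rfl h
      exact h
    exact good_sub hT (key e D.1 D.2 _ h.choose_spec.1 hD) _
  | cons σ Γ ih =>
    cases e with
    | inl b => obtain ⟨e, ⟨b', hb, _⟩, _⟩ := h; cases hb
    | inr e => exact ih hD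

/-- The fundamental lemma of the logical predicate: counit and comultiplication of the colouring
become `AtLevels.bot` and `AtLevels.max`. -/
theorem good_build (hT : IsTail c T J)
    {Γ : List Ty} {σ : Ty} (M : Term S G.ty Γ σ) {ρ : Env S G.ty Γ}
    {u : Finset (A.Col × A.denCtx G.ty Γ)} {x : A.den σ} {h : (A.denTerm G.ty M).rel u x}
    {env : ∀ p ∈ u, A.EnvDer G lab ρ p.2} {k : ℕ}
    (henv : ∀ p hp, AtLevels c p.1 k fun j => GoodEnv c T j (env p hp)) :
    Good c T k (build M h env) := by
  induction M generalizing u k with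
  | const a => rw [build]; exact good_const hT
  | nt F => rw [build]; exact GoodEnv.nt hT (henv _ (A.der_comp_rel.1 h).choose_spec.1).bot
  | var z => rw [build]; exact GoodEnv.var hT z (henv _ (A.der_comp_rel.1 h).choose_spec.1).bot
  | app M P ihM ihP =>
    rw [build]
    refine good_app hT (ihM henv) fun p hp j hd hj => ihP fun z hz => ?_
    exact (henv (max p.1 z.1, z.2) (A.mem_shift.1 hz)).max hd hj

theorem good_buildRule (hT : IsTail c T J)
    {Γ : List Ty} {σ : Ty} (r : Rule S G.ty Γ σ) {ρ : Env S G.ty Γ}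
    {u : Finset (A.Col × A.denCtx G.ty Γ)} {x : A.den σ} {h : (A.denRule G.ty r).rel u x}
    {env : ∀ p ∈ u, A.EnvDer G lab ρ p.2} {as : Args S G.ty σ} {π : A.Stk G lab as x} {k : ℕ}
    (henv : ∀ p hp, AtLevels c p.1 k fun j => GoodEnv c T j (env p hp)) (hπ : GoodStk c T k π) :
    Good c T k (buildRule r h env π) := by
  induction r with
  | body t => cases as; exact good_build hT t henv
  | lam r ih =>
    cases as with
    | cons P as =>
      obtain ⟨h1, h2⟩ := goodStk_cons.1 hπ
      refine ih ?_ h2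
      rintro ⟨d, b | e⟩ hp
      · exact h1 _ (A.mem_seely_inl.1 hp)
      · exact henv _ (A.mem_seely_inr.1 hp)

/-- If no infinite path has `c` as the greatest colour of infinitely many of its segments, then
non-terminals are good. -/
theorem good_nt (hT : IsTail c T J)
    {E : W → A.Col → W → Prop} (hE : ∀ w p hp, E w p.1 (J.next w p hp))
    (hwf : WellFounded fun w' w => Path E w c w') (w : W) :
    ∀ k F x (h : lab w = ⟨F, x⟩), Good c T k (.nt F x w h) := by
  induction w using hwf.induction with
  | _ w ihw =>
    -- The claim is strengthened to all vertices reached from `w` below colour `c`, so that the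
    -- induction on levels can follow edges of smaller colour.
    suffices ∀ k w', (w' = w ∨ ∃ d < c, Path E w d w') → ∀ F x (h : lab w' = ⟨F, x⟩),
        Good c T k (.nt F x w' h) from fun k => this k w (.inl rfl)
    intro k
    induction k using Nat.strong_induction_on with
    | _ k ihk =>
      intro w' hw' F x h i hi as π hπ ht
      obtain ⟨d, s', j', ⟨rfl, rfl⟩, -, ht', hlt, hle⟩ := hT _ _ ht
      have hle := hle rfl
      refine good_buildRule hT (G.rule F) (k := j') (fun p hp j hd hj => ?_) (hπ.mono hle) j' le_rfl
        _ .nil ht'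
      have hedge := hE w' p hp
      change Good c T j (.nt _ _ _ _)
      -- An edge of colour `c` completes a path of greatest colour `c` from `w`, so the outer
      -- hypothesis applies at any level. A smaller colour forces `⊥ < c`, so the silent unfolding
      -- move has lowered the level and the inner hypothesis applies.
      rcases hd.eq_or_lt with hd | hd
      · refine ihw _ ?_ _ _ _ _
        rcases hw' with rfl | ⟨d', hd', hp'⟩
        · exact hd ▸ .single hedge
        · have := hp'.trans (.single hedge)
          rwa [hd, max_eq_right hd'.le] at this
      · have hj : j ≤ j' := hj.resolve_left hd.ne
        have := hlt (bot_le.trans_lt hd)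
        refine ihk j (by omega) _ (.inr ?_) _ _ _
        rcases hw' with rfl | ⟨d', hd', hp'⟩
        · exact ⟨_, hd, .single hedge⟩
        · exact ⟨_, max_lt hd' hd, hp'.trans (.single hedge)⟩

/-- With non-terminals good, induction on derivations and then on stacks makes everything good;
goodness of a derivation against its own stack excludes the configuration from `T`. -/
theorem not_tail (hT : IsTail c T J)
    {E : W → A.Col → W → Prop} (hE : ∀ w p hp, E w p.1 (J.next w p hp))
    (hwf : WellFounded fun w' w => Path E w c w') (k : ℕ) (s : A.Conf G lab) : ¬ T k s := by
  have hD : ∀ {σ : Ty} {M : Term S G.ty [] σ} {x : A.den σ} (D : A.Der G lab M x) (k : ℕ),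
      Good c T k D := by
    intro σ M x D
    induction D with
    | const => exact fun _ => good_const hT
    | nt F x w h => exact fun k => good_nt hT hE hwf w k F x h
    | app v x D B ihD ihB => exact fun k => good_app hT (ihD k) fun p hp j _ _ => ihB p hp j
    | sub x y D h ih => exact fun k => good_sub hT (ih k) h
  have hS : ∀ {σ : Ty} {as : Args S G.ty σ} {x : A.den σ} (π : A.Stk G lab as x),
      GoodStk c T k π := by
    intro σ as
    induction as with
    | nil => exact fun _ => .nil
    | cons P as ih => exact fun π => goodStk_cons.2 ⟨fun p hp j _ _ => hD _ j, ih π.2⟩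
  exact hD s.D k k le_rfl s.π (hS s.π)

end Good

theorem infWin_move {E : W → A.Col → W → Prop} (hE : A.InfWin E) {J : A.Justified G W lab}
    (hJ : ∀ w p hp, E w p.1 (J.next w p hp)) : A.InfWin (Move J) := by
  intro s cs hs
  obtain ⟨c, hc⟩ := exists_limCol cs
  by_contra hlose
  -- An infinite descending chain would be a sequence of paths of constant colour `c`; it wins, so
  -- the play with limit `c` would win as well.
  have hwf : WellFounded fun w' w => Path E w c w' := by
    rw [wellFounded_iff_isEmpty_descending_chain]
    refine ⟨fun ⟨x, hx⟩ => hlose ?_⟩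
    obtain ⟨d, hd, h, -⟩ := hE.path x (fun _ => c) hx
    obtain ⟨n, rfl⟩ := h.exists
    exact ⟨d, hd, hc⟩
  obtain ⟨N, hN⟩ := Filter.eventually_atTop.1 hc.2
  -- The tail starts at `N`, after which no colour exceeds `c`; level `j` means that `c` is played
  -- within the next `j` moves.
  let T : ℕ → A.Conf G lab → Prop := fun j t => ∃ n ≥ N, s n = t ∧ ∃ i < j, cs (n + i) = c
  have hT : IsTail c T J := by
    rintro j _ ⟨n, hn, rfl, i, hi, hci⟩
    rcases (hN n hn).eq_or_lt with hd | hd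
    · by_cases hb : c = ⊥
      · refine ⟨cs n, s (n + 1), j, hs n, hN n hn,
          ⟨n + 1, by omega, rfl, 0, by omega, ?_⟩, fun h => (h.ne hd).elim, fun _ => le_rfl⟩
        have := hN (n + 1) (by omega)
        rw [hb] at this ⊢
        exact le_bot_iff.1 this
      · obtain ⟨m, hm, hcm⟩ := Filter.frequently_atTop.1 hc.1 (n + 1)
        refine ⟨cs n, s (n + 1), m - (n + 1) + 1, hs n, hN n hn,
          ⟨n + 1, by omega, rfl, m - (n + 1), by omega, ?_⟩, fun h => (h.ne hd).elim,
          fun h => (hb (hd ▸ h)).elim⟩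
        rwa [Nat.add_sub_cancel' hm]
    · obtain _ | i := i
      · exact (hd.ne hci).elim
      · refine ⟨cs n, s (n + 1), j - 1, hs n, hN n hn,
          ⟨n + 1, by omega, rfl, i, by omega, ?_⟩, fun _ => by omega, fun _ => by omega⟩
        rw [← hci]
        congr 1
        omega
  obtain ⟨m, hm, hcm⟩ := Filter.frequently_atTop.1 hc.1 N
  refine not_tail hT hJ hwf (m - N + 1) (s N) ⟨N, le_rfl, rfl, m - N, by omega, ?_⟩
  rwa [Nat.add_sub_cancel' hm]

theorem IsSemEval.accepts {E : W → A.Col → W → Prop} (h : A.IsSemEval G lab E) {w₀ : W} {q : A.Q}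
    (h₀ : lab w₀ = ⟨G.start, A.startElt G q⟩) : A.Accepts G.valueTree q := by
  choose v hv hrel using h.step
  choose next hE hlab using hv
  let J : A.Justified G W lab := ⟨v, next, hlab, fun w F x hw => by
    have := hrel w
    rwa [hw] at this⟩
  -- Again the type is generalised to remove the cast along `G.start_ty`.
  have hstart : ∀ (σ : Ty) (hσ : σ = .o) (M : Term S G.ty [] σ) (q : A.Q)
      (_ : A.Der G lab M (hσ.symm ▸ (show A.den .o from q) : A.den σ)),
      ∃ s : A.Conf G lab, s.term = hσ ▸ M ∧ s.st = q := by
    rintro _ rfl M q D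
    exact ⟨.ground D, rfl, rfl⟩
  obtain ⟨s, hs, rfl⟩ := hstart _ G.start_ty _ q (.nt G.start _ w₀ h₀)
  exact IsWeakEval.accepts ⟨Move.step J, infWin_move h.win hE⟩ hs

end APT

end HOMC

theorem mainTheorem1 (S : HOMC.Sig) (G : HOMC.HORS S) (A : HOMC.APT S) (q₀ : A.Q) :
    A.Accepts G.valueTree q₀ ↔ q₀ ∈ A.interp G := by
  refine ⟨HOMC.APT.mem_interp_of_accepts, fun h => ?_⟩
  obtain ⟨W, lab, E, w₀, hE, hw⟩ := HOMC.APT.exists_isSemEval_of_fixRel h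
  exact hE.accepts hw
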